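/- A multilayer synchronous dynamical system (MSyDS) with $k \ge 1$ layers on a finite node set $V$ consists of undirected simple graphs $G_1,\dots,G_k$ on $V$, a local function $f_{i,v}\colon\{0,1\}^{N_i[v]}\to\{0,1\}$ for every layer $i$ and node $v$, where $N_i[v]$ is the closed neighborhood of $v$ in $G_i$ (the node $v$ and its neighbors), and an arbitrary master function $\psi_v\colon\{0,1\}^k\to\{0,1\}$ for every node $v$. The successor of a configuration $C\in\{0,1\}^V$ is the configuration whose value at $v$ is $\psi_v\bigl(f_{1,v}(C|_{N_1[v]}),\dots,f_{k,v}(C|_{N_k[v]})\bigr)$. The phase space is the directed graph on $\{0,1\}^V$ with an edge from each configuration to its successor. Two MSyDSs on the same node set are equivalent if their phase spaces are identical. A Boolean function is symmetric if its value depends only on the number of 1s in its input. **Theorem.** (1) For every fixed $K$, the following problem is decidable in polynomial time (by a deterministic Turing machine, in the length of the input): given two MSyDSs on the same node set, each with at most $K$ layers, with symmetric local functions and arbitrary master functions, are they equivalent? Here each node and layer is given by the indicator vector of the closed neighborhood and the table of the values of the symmetric local function by number of 1s, and each master function by its truth table. (2) Let $S_0$ and $S_1$ be MSyDSs on the same finite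 node set $V$ with $k_0$ and $k_1$ layers, all of whose local functions are symmetric. For every $v\in V$ there are a partition $\Pi_v$ of $V$ into at most $2^{k_0+k_1}$ blocks and functions $\rho_{v,0},\rho_{v,1}\colon\mathbb{N}^{\Pi_v}\to\{0,1\}$ such that, for $a\in\{0,1\}$ and every configuration $C$, the value at $v$ of the successor of $C$ under $S_a$ is $\rho_{v,a}$ of the profile of $C$, i.e. of the vector that counts the nodes in state 1 in each block of $\Pi_v$. Moreover, $S_0$ and $S_1$ are equivalent if and only if $\rho_{v,0}(\theta)=\rho_{v,1}(\theta)$ for every $v\in V$ and every $\theta\in\mathbb{N}^{\Pi_v}$ with $\theta(B)\le|B|$ for all blocks $B$. -/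

import Mathlib

universe u

/-- The closed neighborhood of `v` in `G`: the node `v` together with its neighbors. -/
def closedNbhd {V : Type u} (G : SimpleGraph V) (v : V) : Set V :=
  {u | u = v ∨ G.Adj v u}

/-- The number of ones in a Boolean input vector (with finitely many positions). -/
noncomputable def numOnes {ι : Type u} (x : ι → Bool) : ℕ :=
  Set.ncard {i | x i = true}

/-- A Boolean function is symmetric if its value depends only on the number of ones in the input. -/
def IsSymmetricFn {ι : Type u} (f : (ι → Bool) → Bool) : Prop :=
  ∀ x y : ι → Bool, numOnes x = numOnes y → f x = f y

/-- A multilayer synchronous dynamical system over `{0, 1}` with node set `V` and `k ≥ 1` layers: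
a graph on `V` for each layer, a local function for each layer and node, whose inputs are the states
of the closed neighborhood of the node in that layer, and an arbitrary master function for each
node, whose inputs are the values of the `k` local functions of the node. -/
structure MSyDS (V : Type u) (k : ℕ) where
  layers_pos : 1 ≤ k
  graph : Fin k → SimpleGraph V
  localFn : (i : Fin k) → (v : V) → (closedNbhd (graph i) v → Bool) → Bool
  master : V → (Fin k → Bool) → Bool

namespace MSyDS

variable {V : Type u} {k k' : ℕ}

/-- The successor of a configuration. -/
def succ (S : MSyDS V k) (C : V → Bool) : V → Bool :=
  fun v => S.master v (fun i => S.localFn i v (fun w => C w))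

/-- The phase space: the directed graph on all configurations in which the only edge out of a
configuration leads to its successor. -/
def phaseSpace (S : MSyDS V k) : Digraph (V → Bool) where
  Adj x y := y = S.succ x

/-- Two systems on the same node set are equivalent if their phase spaces are identical. -/
def Equivalent (S : MSyDS V k) (S' : MSyDS V k') : Prop :=
  S.phaseSpace = S'.phaseSpace

/-- All local functions of the system are symmetric. -/
def SymmetricLocal (S : MSyDS V k) : Prop :=
  ∀ i v, IsSymmetricFn (S.localFn i v)

end MSyDS

/-! ### Profiles -/

/-- The profile of a configuration with respect to a partition of the nodes: the number of nodes in
state `1` in each block. -/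
def profile {V : Type u} [Fintype V] [DecidableEq V] (P : Finpartition (Finset.univ : Finset V))
    (C : V → Bool) : P.parts → ℕ :=
  fun B => (B.1.filter (fun w => C w = true)).card

/-! ### Problem instances and their encoding as strings -/

/-- An instance of the equivalence problem with at most `K` layers and symmetric local functions:
two systems with the same node set `{0, …, n - 1}`. -/
structure EquivInstance (K : ℕ) where
  n : ℕ
  k₀ : ℕ
  k₁ : ℕ
  k₀_le : k₀ ≤ K
  k₁_le : k₁ ≤ K
  S₀ : MSyDS (Fin n) k₀
  S₁ : MSyDS (Fin n) k₁
  symm₀ : S₀.SymmetricLocal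
  symm₁ : S₁.SymmetricLocal

/-- The question asked about an instance. -/
def EquivInstance.IsYes {K : ℕ} (I : EquivInstance K) : Prop :=
  I.S₀.Equivalent I.S₁

open Classical in
/-- The indicator vector of a set of nodes. -/
noncomputable def indicatorBits {n : ℕ} (s : Set (Fin n)) : List Bool :=
  (List.finRange n).map (fun w => decide (w ∈ s))

open Classical in
/-- The symmetry table of a symmetric function `f` with `q` inputs: row `j`, for `0 ≤ j ≤ q`, is the
value of `f` on the inputs with exactly `j` ones. -/
noncomputable def symmetryTable {ι : Type u} (f : (ι → Bool) → Bool) : List Bool :=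
  (List.range (Nat.card ι + 1)).map (fun j => decide (∃ x, numOnes x = j ∧ f x = true))

/-- The truth table of a Boolean function with `k` inputs; row `b` is the value on the binary digits
of `b`, for `0 ≤ b < 2 ^ k`. -/
def truthTable {k : ℕ} (f : (Fin k → Bool) → Bool) : List Bool :=
  (List.range (2 ^ k)).map (fun b => f (fun i => b.testBit i))

/-- The description of the node `v` of a system: for each layer the indicator vector of the closed
neighborhood of `v` (the row of `v` in the adjacency matrix, with ones on the diagonal) and the
symmetry table of the local function, and then the truth table of the master function. -/
noncomputable def MSyDS.nodeFields {n k : ℕ} (S : MSyDS (Fin n) k) (v : Fin n) :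
    List (List Bool) :=
  (List.finRange k).flatMap
    (fun i => [indicatorBits (closedNbhd (S.graph i) v), symmetryTable (S.localFn i v)])
  ++ [truthTable (S.master v)]

/-- The description of an instance: the numbers `n`, `k₀`, `k₁` in unary, and then for each node its
description in the first and in the second system. -/
noncomputable def EquivInstance.fields {K : ℕ} (I : EquivInstance K) : List (List Bool) :=
  [List.replicate I.n true, List.replicate I.k₀ true, List.replicate I.k₁ true]
  ++ (List.finRange I.n).flatMap (fun v => I.S₀.nodeFields v ++ I.S₁.nodeFields v)

/-- A list of bit strings as one string over the three-letter alphabet `Option Bool`, in which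
`none` is an end marker after each bit string. -/
def joinFields (L : List (List Bool)) : List (Option Bool) :=
  L.flatMap (fun l => l.map some ++ [none])

/-- The string that encodes an instance. -/
noncomputable def EquivInstance.encode {K : ℕ} (I : EquivInstance K) : List (Option Bool) :=
  joinFields I.fields

/-! ### Polynomial time -/

open Classical in
/-- The predicate `P` is decidable in polynomial time with respect to the encoding `enc`: some
Turing machine (with finitely many stacks over finite alphabets) computes the truth value of `P a`
from `enc a` in a number of steps that is bounded by a polynomial in the length of `enc a`. -/
def DecidableInPolyTime {α Γ : Type} (enc : α → List Γ) (P : α → Prop) : Prop :=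
  ∃ M : Turing.TM2ComputableInPolyTime enc Computability.encodeBool (fun a => decide (P a)),
    ∀ s, Finite (M.tm.Γ s)

/-! ### The encoding is injective -/

theorem joinFields_injective : Function.Injective joinFields := by
  intro L
  induction L with
  | nil =>
    intro L' h
    cases L' with
    | nil => rfl
    | cons l L' => simp [joinFields] at h
  | cons l L ih =>
    intro L' h
    cases L' with
    | nil => simp [joinFields] at h
    | cons l' L' =>
      have key : ∀ (a b : List Bool) (x y : List (Option Bool)),
          a.map some ++ none :: x = b.map some ++ none :: y → a = b ∧ x = y := by
        intro a
        induction a with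
        | nil => intro b x y h; cases b <;> simp_all
        | cons c a iha =>
          intro b x y h
          cases b with
          | nil => simp at h
          | cons d b =>
            simp only [List.map_cons, List.cons_append, List.cons.injEq, Option.some.injEq] at h
            obtain ⟨h1, h2⟩ := iha b x y h.2
            exact ⟨by rw [h.1, h1], h2⟩
      have h' : l.map some ++ none :: joinFields L = l'.map some ++ none :: joinFields L' := by
        simpa [joinFields] using h
      obtain ⟨h1, h2⟩ := key _ _ _ _ h'
      rw [h1, ih h2]

theorem flatMap_eq_of_length {α β : Type*} (f g : α → List β) (l : List α)
    (hl : ∀ a ∈ l, (f a).length = (g a).length) (h : l.flatMap f = l.flatMap g) :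
    ∀ a ∈ l, f a = g a := by
  induction l with
  | nil => simp
  | cons a l ih =>
    simp only [List.flatMap_cons] at h
    obtain ⟨h1, h2⟩ := List.append_inj h (hl a (by simp))
    intro b hb
    rcases List.mem_cons.1 hb with rfl | hb
    · exact h1
    · exact ih (fun c hc => hl c (by simp [hc])) h2 b hb

theorem indicatorBits_injective {n : ℕ} :
    Function.Injective (indicatorBits : Set (Fin n) → List Bool) := by
  intro s t h
  ext w
  simpa using List.map_inj_left.1 h w (List.mem_finRange w)

theorem symmetryTable_inj {ι : Type u} [Finite ι] {f g : (ι → Bool) → Bool}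
    (hf : IsSymmetricFn f) (hg : IsSymmetricFn g) (h : symmetryTable f = symmetryTable g) :
    f = g := by
  have val : ∀ {e : (ι → Bool) → Bool}, IsSymmetricFn e → ∀ x,
      ((∃ y, numOnes y = numOnes x ∧ e y = true) ↔ e x = true) := fun he x =>
    ⟨fun ⟨y, hy, hy'⟩ => (he y x hy) ▸ hy', fun hx => ⟨x, rfl, hx⟩⟩
  funext x
  have hx : numOnes x ∈ List.range (Nat.card ι + 1) := by
    rw [List.mem_range, Nat.lt_succ_iff]
    exact Set.ncard_le_card _
  have := List.map_inj_left.1 h _ hx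
  rw [decide_eq_decide, val hf, val hg] at this
  exact Bool.eq_iff_iff.2 this

theorem truthTable_injective {k : ℕ} :
    Function.Injective (truthTable : ((Fin k → Bool) → Bool) → List Bool) := by
  intro f g h
  funext x
  have := List.map_inj_left.1 h (Nat.ofBits x) (List.mem_range.2 (Nat.ofBits_lt_two_pow x))
  simpa using this

theorem MSyDS.nodeFields_length {n k : ℕ} (S : MSyDS (Fin n) k) (v : Fin n) :
    (S.nodeFields v).length = k * 2 + 1 := by
  simp [MSyDS.nodeFields, List.length_flatMap]

theorem MSyDS.eq_of_nodeFields {n k : ℕ} {S T : MSyDS (Fin n) k} (hS : S.SymmetricLocal)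
    (hT : T.SymmetricLocal) (h : ∀ v, S.nodeFields v = T.nodeFields v) : S = T := by
  have h1 : ∀ v, S.master v = T.master v := fun v => by
    have := (List.append_inj' (h v) (by simp)).2
    exact truthTable_injective (by simpa using this)
  have h2 : ∀ v i, closedNbhd (S.graph i) v = closedNbhd (T.graph i) v ∧
      symmetryTable (S.localFn i v) = symmetryTable (T.localFn i v) := fun v i => by
    have := flatMap_eq_of_length _ _ _ (by simp) (List.append_inj' (h v) (by simp)).1 i
      (List.mem_finRange i)
    simp only [List.cons.injEq, and_true] at this
    exact ⟨indicatorBits_injective this.1, this.2⟩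
  obtain ⟨pS, gS, fS, mS⟩ := S
  obtain ⟨pT, gT, fT, mT⟩ := T
  have hg : gS = gT := by
    funext i
    ext v w
    have := Set.ext_iff.1 (h2 v i).1 w
    simp only [closedNbhd, Set.mem_ofPred_eq] at this
    by_cases hvw : w = v
    · subst hvw; simp
    · simpa [hvw] using this
  subst hg
  have hm : mS = mT := funext h1
  have hf : fS = fT := by
    funext i v
    exact symmetryTable_inj (hS i v) (hT i v) (h2 v i).2
  rw [hm, hf]

theorem EquivInstance.encode_injective {K : ℕ} :
    Function.Injective (EquivInstance.encode : EquivInstance K → List (Option Bool)) := by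
  intro I J h
  have h := joinFields_injective h
  obtain ⟨n, k₀, k₁, a, b, S₀, S₁, s₀, s₁⟩ := I
  obtain ⟨n', k₀', k₁', a', b', T₀, T₁, t₀, t₁⟩ := J
  obtain ⟨h1, h2⟩ := List.append_inj h (by simp)
  simp only [List.cons.injEq, and_true] at h1
  obtain ⟨hn, h0, h1⟩ := h1
  have hn := congrArg List.length hn
  have h0 := congrArg List.length h0
  have h1 := congrArg List.length h1
  simp only [List.length_replicate] at hn h0 h1
  subst hn h0 h1
  have h3 : ∀ v, S₀.nodeFields v ++ S₁.nodeFields v = T₀.nodeFields v ++ T₁.nodeFields v :=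
    fun v => flatMap_eq_of_length _ _ _ (by simp [MSyDS.nodeFields_length]) h2 v
      (List.mem_finRange v)
  have h4 := fun v => List.append_inj (h3 v) (by simp [MSyDS.nodeFields_length])
  have e0 := MSyDS.eq_of_nodeFields s₀ t₀ (fun v => (h4 v).1)
  have e1 := MSyDS.eq_of_nodeFields s₁ t₁ (fun v => (h4 v).2)
  subst e0 e1
  rfl

/-! Fix a node `v` and let the type of a node record in which of the `k₀ + k₁` closed neighborhoods
of `v` it lies. There are at most `2 ^ (k₀ + k₁)` types, and each of these neighborhoods is a union
of type classes. Hence the number of ones in each class determines the number of ones in each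
neighborhood, and by symmetry the local values and the next state of `v`
(`MSyDS.succ_eq_of_profile_eq`). Conversely, all counts that do not exceed the class sizes come from
a configuration (`exists_config_of_le_fiber`). So equivalence means agreement on all feasible
profiles at every node. With `n` nodes at most `(n + 1) ^ 2 ^ (k₀ + k₁)` profiles have to be tried
per node, which is polynomial in `n` for bounded `k₀` and `k₁`.

For the time bound, the test is a formula `EquivString.Agree` about the input string, built from
bounded sums, bounded quantifiers and arithmetic. All its values are polynomially bounded, so unary
registers suffice. `PolyComputable` is closed under these constructions, the essential one being
`PolyComputable.sum`, and counter programs translate step by step into stack machines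
(`CounterProg.Run.reachesIn`). `EquivString.isYes_iff_agree` shows that the formula is correct on
encodings. -/

/-! ### Counter programs with a read-only input -/

open Turing

/-- Programs that act on natural-number registers and on an input string that is split at the
position of a reading head. -/
inductive CounterProg (α : Type)
  | inc (r : ℕ)
  | dec (r : ℕ)
  /-- move the head one position to the right -/
  | right
  /-- move the head back to the start of the input -/
  | rewind
  /-- move the head to the end of the input and increment `r` at each move -/
  | scan (r : ℕ)
  /-- increment `r` if the symbol at the head is `a` -/
  | probe (a : α) (r : ℕ)
  | seq (p q : CounterProg α)
  /-- while `r` is not zero, decrement it and run `p` -/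
  | loop (r : ℕ) (p : CounterProg α)

namespace CounterProg

variable {α : Type}

/-- The state of a counter program: the part of the input to the left of the head, in reverse order,
the rest of the input, and the registers. -/
structure State (α : Type) where
  left : List α
  right : List α
  reg : ℕ → ℕ

open Classical in
/-- `Run p s t s'`: the program `p`, started in `s`, ends in `s'` after `t` steps. -/
inductive Run : CounterProg α → State α → ℕ → State α → Prop
  | inc (r l x g) : Run (inc r) ⟨l, x, g⟩ 1 ⟨l, x, Function.update g r (g r + 1)⟩
  | dec (r l x g) : Run (dec r) ⟨l, x, g⟩ 1 ⟨l, x, Function.update g r (g r - 1)⟩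
  | right_nil (l g) : Run right ⟨l, [], g⟩ 1 ⟨l, [], g⟩
  | right_cons (l a x g) : Run right ⟨l, a :: x, g⟩ 1 ⟨a :: l, x, g⟩
  | rewind_nil (x g) : Run rewind ⟨[], x, g⟩ 1 ⟨[], x, g⟩
  | rewind_cons {a l x g t s} (h : Run rewind ⟨l, a :: x, g⟩ t s) :
      Run rewind ⟨a :: l, x, g⟩ (1 + t) s
  | scan_nil (r l g) : Run (scan r) ⟨l, [], g⟩ 1 ⟨l, [], g⟩
  | scan_cons {r a l x g t s}
      (h : Run (scan r) ⟨a :: l, x, Function.update g r (g r + 1)⟩ t s) :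
      Run (scan r) ⟨l, a :: x, g⟩ (1 + t) s
  | probe (a r l x g) : Run (probe a r) ⟨l, x, g⟩ 1
      ⟨l, x, Function.update g r (g r + if x.head? = some a then 1 else 0)⟩
  | seq {p q s t s' t' s''} (h : Run p s t s') (h' : Run q s' t' s'') :
      Run (seq p q) s (t + t') s''
  | loop_zero {r p l x g} (h : g r = 0) : Run (loop r p) ⟨l, x, g⟩ 1 ⟨l, x, g⟩
  | loop_succ {r p l x g t s t' s'} (h : g r ≠ 0)
      (hp : Run p ⟨l, x, Function.update g r (g r - 1)⟩ t s)
      (hl : Run (loop r p) s t' s') : Run (loop r p) ⟨l, x, g⟩ (1 + t + t') s'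

/-- A bound on the registers of a program. -/
def bound : CounterProg α → ℕ
  | inc r => r
  | dec r => r
  | right => 0
  | rewind => 0
  | scan r => r
  | probe _ r => r
  | seq p q => max p.bound q.bound
  | loop r p => max r p.bound

/-! ### Translation to Turing machines -/

/-- The stack alphabets: two stacks for the input, and a stack for each register. -/
abbrev Alphabet (α : Type) (R : ℕ) : Bool ⊕ Fin (R + 1) → Type
  | Sum.inl _ => α
  | Sum.inr _ => Bool

/-- The labels of the machine for a program. -/
def Label : CounterProg α → Type
  | inc _ => Unit
  | dec _ => Unit
  | right => Unit
  | rewind => Unit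
  | scan _ => Unit
  | probe _ _ => Unit
  | seq p q => p.Label ⊕ q.Label
  | loop _ p => Option p.Label

instance finiteLabel : ∀ p : CounterProg α, Finite p.Label
  | inc _ => inferInstanceAs (Finite Unit)
  | dec _ => inferInstanceAs (Finite Unit)
  | right => inferInstanceAs (Finite Unit)
  | rewind => inferInstanceAs (Finite Unit)
  | scan _ => inferInstanceAs (Finite Unit)
  | probe _ _ => inferInstanceAs (Finite Unit)
  | seq p q => by
    have := finiteLabel p
    have := finiteLabel q
    exact inferInstanceAs (Finite (p.Label ⊕ q.Label))
  | loop _ p => by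
    have := finiteLabel p
    exact inferInstanceAs (Finite (Option p.Label))

/-- The label at which the machine for a program starts. -/
def entry : (p : CounterProg α) → p.Label
  | inc _ => ()
  | dec _ => ()
  | right => ()
  | rewind => ()
  | scan _ => ()
  | probe _ _ => ()
  | seq p _ => Sum.inl p.entry
  | loop _ _ => none

section

variable {R : ℕ} {Λ : Type}

/-- The stack of a register. -/
abbrev regStack (R r : ℕ) : Bool ⊕ Fin (R + 1) := Sum.inr (Fin.ofNat (R + 1) r)

/-- The stack of the part of the input to the left (`false`) or right (`true`) of the head. -/
abbrev inStack (R : ℕ) (b : Bool) : Bool ⊕ Fin (R + 1) := Sum.inl b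

/-- A machine statement over the stacks of a counter program; the internal state of the machine
holds the symbol read last. -/
abbrev MStmt (α : Type) (R : ℕ) (Λ : Type) := TM2.Stmt (Alphabet α R) Λ (Option α)

/-- Move the top symbol from one input stack to the other, and go on with `q` or, if the stack was
empty, with `q'`. -/
def moveStmt [Inhabited α] (b b' : Bool) (q q' : MStmt α R Λ) : MStmt α R Λ :=
  .pop (inStack R b) (fun _ o => o) (.branch Option.isSome
    (.push (inStack R b') (fun v => (v.getD default : α)) q) q')

open Classical in
/-- The machine for a program, with the labels embedded by `e` and exit `x`. -/
noncomputable def code [Inhabited α] (R : ℕ) :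
    (p : CounterProg α) → {Λ : Type} → (p.Label → Λ) → Λ → p.Label → MStmt α R Λ
  | inc r, _, _, x, _ => .push (regStack R r) (fun _ => true) (.goto fun _ => x)
  | dec r, _, _, x, _ => .pop (regStack R r) (fun v _ => v) (.goto fun _ => x)
  | right, _, _, x, _ => moveStmt true false (.goto fun _ => x) (.goto fun _ => x)
  | rewind, _, e, x, _ => moveStmt false true (.goto fun _ => e ()) (.goto fun _ => x)
  | scan r, _, e, x, _ =>
    moveStmt true false (.push (regStack R r) (fun _ => true) (.goto fun _ => e ())) (.goto fun _ => x)
  | probe a r, _, _, x, _ =>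
    .peek (inStack R true) (fun _ o => o) (.branch (fun v => decide (v = some a))
      (.push (regStack R r) (fun _ => true) (.goto fun _ => x)) (.goto fun _ => x))
  | seq p q, _, e, x, l => match l with
    | Sum.inl l => p.code R (e ∘ Sum.inl) (e (Sum.inr q.entry)) l
    | Sum.inr l => q.code R (e ∘ Sum.inr) x l
  | loop r p, _, e, x, l => match l with
    | none => .pop (regStack R r) (fun _ o => o.map fun _ => default) (.branch Option.isSome
      (.goto fun _ => e (some p.entry)) (.goto fun _ => x))
    | some l => p.code R (e ∘ some) (e none) l

/-- The stacks that represent a state. -/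
def State.stacks (R : ℕ) (s : State α) : ∀ k, List (Alphabet α R k)
  | Sum.inl false => s.left
  | Sum.inl true => s.right
  | Sum.inr i => List.replicate (s.reg i) true

/-- `c'` is reached from `c` after `t` steps. -/
def ReachesIn (M : Λ → MStmt α R Λ) (t : ℕ)
    (c c' : TM2.Cfg (Alphabet α R) Λ (Option α)) : Prop :=
  (flip bind (TM2.step M))^[t] (some c) = some c'

theorem ReachesIn.trans {M : Λ → MStmt α R Λ} {t t' : ℕ} {c c' c''} (h : ReachesIn M t c c')
    (h' : ReachesIn M t' c' c'') : ReachesIn M (t + t') c c'' := by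
  unfold ReachesIn at *
  rw [Nat.add_comm t t', Function.iterate_add_apply, h, h']

theorem ReachesIn.single {M : Λ → MStmt α R Λ} {l : Λ} {v : Option α} {S c'}
    (h : TM2.stepAux (M l) v S = c') : ReachesIn M 1 ⟨some l, v, S⟩ c' := by
  subst h
  rfl

/-- `regStack` reduces `r` modulo `R + 1`; for `r ≤ R` no two registers share a stack. -/
theorem update_regStack {s : State α} {r : ℕ} (hr : r ≤ R) (c : ℕ) (L : List Bool)
    (hL : L = List.replicate c true) :
    Function.update (s.stacks R) (regStack R r) L =
      State.stacks R ⟨s.left, s.right, Function.update s.reg r c⟩ := by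
  subst hL
  funext k
  rcases k with (_ | _) | i
  · simp [State.stacks]
  · simp [State.stacks]
  · by_cases h : i = Fin.ofNat (R + 1) r
    · subst h
      simp [State.stacks, Nat.mod_eq_of_lt (Nat.lt_succ_of_le hr)]
    · have h' : (i : ℕ) ≠ r := fun e => h (by
        ext; simp [← e])
      rw [Function.update_of_ne (by simpa using h)]
      simp [State.stacks, h']

theorem stacks_regStack {s : State α} {r : ℕ} (hr : r ≤ R) :
    s.stacks R (regStack R r) = List.replicate (s.reg r) true := by
  simp [State.stacks, Nat.mod_eq_of_lt (Nat.lt_succ_of_le hr)]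

theorem update_left {s : State α} (L : List α) :
    Function.update (s.stacks R) (inStack R false) L = State.stacks R ⟨L, s.right, s.reg⟩ := by
  funext k
  rcases k with (_ | _) | i <;> simp [State.stacks, inStack]

theorem update_right {s : State α} (L : List α) :
    Function.update (s.stacks R) (inStack R true) L = State.stacks R ⟨s.left, L, s.reg⟩ := by
  funext k
  rcases k with (_ | _) | i <;> simp [State.stacks, inStack]

/-- Induction on the run. The surrounding machine, the embedding of the labels and the exit are
arbitrary, so that the code of a subprogram can be used in place inside `seq` and `loop`. The
internal state only remembers the last symbol read, so its final value is left open. -/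
theorem Run.reachesIn [Inhabited α] {p : CounterProg α} {s s' : State α} {t : ℕ}
    (h : Run p s t s') (hR : p.bound ≤ R) : ∀ {Λ : Type} (M : Λ → MStmt α R Λ) (e : p.Label → Λ)
      (x : Λ) (_ : ∀ l, M (e l) = p.code R e x l) (v : Option α),
      ∃ v', ReachesIn M t ⟨some (e p.entry), v, s.stacks R⟩ ⟨some x, v', s'.stacks R⟩ := by
  induction h with
  | inc r l y g =>
    intro Λ M e x hM v
    refine ⟨v, ReachesIn.single ?_⟩
    rw [hM]
    simp only [code, TM2.stepAux, stacks_regStack (show r ≤ R from hR)]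
    rw [update_regStack (show r ≤ R from hR) (g r + 1) _ (by simp [List.replicate_succ])]
  | dec r l y g =>
    intro Λ M e x hM v
    refine ⟨v, ReachesIn.single ?_⟩
    rw [hM]
    simp only [code, TM2.stepAux, stacks_regStack (show r ≤ R from hR)]
    rw [update_regStack (show r ≤ R from hR) (g r - 1) _ (by simp)]
  | right_nil l g =>
    intro Λ M e x hM v
    refine ⟨none, ReachesIn.single ?_⟩
    rw [hM]
    simp [code, moveStmt, State.stacks, update_right]
  | right_cons l a y g =>
    intro Λ M e x hM v
    refine ⟨some a, ReachesIn.single ?_⟩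
    rw [hM]
    simp [code, moveStmt, State.stacks, update_right, update_left]
  | rewind_nil y g =>
    intro Λ M e x hM v
    refine ⟨none, ReachesIn.single ?_⟩
    rw [hM]
    simp [code, moveStmt, State.stacks, update_right, update_left]
  | @rewind_cons a l y g t s h ih =>
    intro Λ M e x hM v
    obtain ⟨v', h'⟩ := ih hR M e x hM (some a)
    refine ⟨v', ReachesIn.trans (ReachesIn.single ?_) h'⟩
    rw [hM]
    simp [code, moveStmt, State.stacks, update_right, update_left]
    trivial
  | scan_nil r l g =>
    intro Λ M e x hM v
    refine ⟨none, ReachesIn.single ?_⟩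
    rw [hM]
    simp [code, moveStmt, State.stacks, update_right, update_left]
  | @scan_cons r a l y g t s h ih =>
    intro Λ M e x hM v
    obtain ⟨v', h'⟩ := ih hR M e x hM (some a)
    refine ⟨v', ReachesIn.trans (ReachesIn.single ?_) h'⟩
    rw [hM]
    have hr : r ≤ R := hR
    simp only [code, moveStmt, TM2.stepAux]
    simp only [State.stacks, update_right, update_left, List.head?_cons, List.tail_cons,
      Option.isSome_some, Option.getD_some, cond_true]
    rw [update_regStack hr (g r + 1) _
      (by simp [List.replicate_succ, Nat.mod_eq_of_lt (Nat.lt_succ_of_le hr)])]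
    rfl
  | probe a r l y g =>
    intro Λ M e x hM v
    refine ⟨y.head?, ReachesIn.single ?_⟩
    rw [hM]
    have hr : r ≤ R := hR
    by_cases h : y.head? = some a
    · simp only [code, TM2.stepAux]
      rw [stacks_regStack hr, update_regStack hr (g r + 1) _ (by simp [List.replicate_succ])]
      simp [State.stacks, h]
    · simp only [code, TM2.stepAux]
      simp [State.stacks, h]
  | seq h h' ih ih' =>
    intro Λ M e x hM v
    obtain ⟨v1, h1⟩ := ih (le_trans (le_max_left _ _) hR) M _ _ (fun l => hM (Sum.inl l)) v
    obtain ⟨v2, h2⟩ := ih' (le_trans (le_max_right _ _) hR) M _ _ (fun l => hM (Sum.inr l)) v1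
    exact ⟨v2, h1.trans h2⟩
  | @loop_zero r p l y g h =>
    intro Λ M e x hM v
    have hr : r ≤ R := le_trans (le_max_left _ _) hR
    refine ⟨none, ReachesIn.single ?_⟩
    rw [hM]
    simp only [code, entry, TM2.stepAux]
    rw [stacks_regStack hr, update_regStack hr 0 _ (by simp [h])]
    have hg : Function.update g r 0 = g := by rw [← h, Function.update_eq_self]
    simp [h, hg]
  | @loop_succ r p l y g t s t' s' h hp hl ih ih' =>
    intro Λ M e x hM v
    have hr : r ≤ R := le_trans (le_max_left _ _) hR
    obtain ⟨v1, h1⟩ := ih (le_trans (le_max_right _ _) hR) M _ _ (fun l => hM (some l))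
      (some default)
    obtain ⟨v2, h2⟩ := ih' hR M _ _ hM v1
    refine ⟨v2, ReachesIn.trans (ReachesIn.trans (ReachesIn.single ?_) h1) h2⟩
    rw [hM]
    simp only [code, entry, TM2.stepAux]
    rw [stacks_regStack hr, update_regStack hr (g r - 1) _ (by simp)]
    obtain ⟨c, hc⟩ := Nat.exists_eq_succ_of_ne_zero h
    simp [hc, List.replicate_succ]

/-- The machine that runs a program and then outputs whether register `0` is not zero. -/
noncomputable def machine [Fintype α] [Inhabited α] (p : CounterProg α) : FinTM2 where
  K := Bool ⊕ Fin (p.bound + 1)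
  k₀ := inStack p.bound true
  k₁ := regStack p.bound 0
  Γ := Alphabet α p.bound
  Λ := Option p.Label
  main := some p.entry
  ΛFin := Fintype.ofFinite _
  σ := Option α
  initialState := none
  Γk₀Fin := inferInstanceAs (Fintype α)
  m
    | some l => p.code p.bound some none l
    | none => .pop (inStack p.bound true) (fun _ o => o) (.branch Option.isSome
        (.goto fun _ => none)
        (.pop (regStack p.bound 0) (fun _ o => o.map fun _ => default)
          (.push (regStack p.bound 0) (fun v => v.isSome) (.load (fun _ => none) .halt))))

/-- A halting configuration must have empty stacks apart from the output, and the initial internal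
state. So the input is popped symbol by symbol, and the last step replaces the unary register `0` by
one Boolean. -/
theorem machine_clear [Fintype α] [Inhabited α] (p : CounterProg α) (b : Bool) (x : List α) :
    ∀ v, ReachesIn (R := p.bound) p.machine.m (x.length + 1)
      ⟨some none, v, State.stacks p.bound ⟨[], x, Function.update 0 0 (if b then 1 else 0)⟩⟩
      (haltList p.machine [b]) := by
  induction x with
  | nil =>
    intro v
    refine ReachesIn.single ?_
    simp only [machine, TM2.stepAux, haltList]
    simp only [State.stacks, List.head?_nil, Option.isSome_none, cond_false, List.tail_nil,
      update_right, Function.update_self, Function.update_idem]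
    congr 1
    funext k
    rcases k with (_ | _) | i
    · simp [State.stacks]
    · simp [State.stacks]
    · by_cases h : i = 0
      · subst h
        refine Eq.trans ?_ (dif_pos (show Sum.inr 0 = regStack p.bound 0 from rfl)).symm
        cases b <;> exact Function.update_self ..
      · have h' : (i : ℕ) ≠ 0 := fun e => h (Fin.ext e)
        simp [State.stacks, h, h']
  | cons a x ih =>
    intro v
    rw [List.length_cons, Nat.add_comm (x.length + 1) 1]
    refine ReachesIn.trans (ReachesIn.single ?_) (ih (some a))
    simp [machine, State.stacks, update_right]

open Classical in
theorem decidableInPolyTime_of_run [Fintype α] [Inhabited α] {A : Type} {enc : A → List α}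
    {P : A → Prop} (p : CounterProg α) (T : Polynomial ℕ)
    (h : ∀ a, ∃ t ≤ T.eval (enc a).length, Run p ⟨[], enc a, 0⟩ t
      ⟨[], enc a, Function.update 0 0 (if P a then 1 else 0)⟩) :
    DecidableInPolyTime enc P := by
  -- The summand `X + 1` pays for clearing the input stack.
  refine ⟨⟨⟨p.machine, Equiv.refl α, Equiv.refl Bool⟩, T + Polynomial.X + 1, fun a => ?_⟩, ?_⟩
  · apply Classical.choice
    obtain ⟨t, ht, hr⟩ := h a
    obtain ⟨v, hv⟩ := hr.reachesIn le_rfl p.machine.m some none (fun _ => rfl) none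
    have hc := hv.trans (by simpa using machine_clear p (decide (P a)) (enc a) v)
    refine ⟨⟨⟨t + ((enc a).length + 1), ?_⟩, ?_⟩⟩
    · have h1 : initList p.machine (List.map (Equiv.refl α).invFun (enc a)) =
          ⟨some (some p.entry), none, State.stacks p.bound ⟨[], enc a, 0⟩⟩ := by
        simp only [initList, machine]
        congr 1
        funext k
        rcases k with (_ | _) | i <;> simp [State.stacks]
        rfl
      rw [h1]
      exact hc
    · simp
      omega
  · rintro (_ | _)
    · exact inferInstanceAs (Finite α)
    · exact inferInstanceAs (Finite Bool)

end

end CounterProg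

/-! ### Functions computed by counter programs in polynomial time -/

namespace CounterProg

open Function Polynomial

variable {α : Type}

/-- The program `p`, started in `s`, ends in `s'` after at most `t` steps. -/
def RunWithin (p : CounterProg α) (s : State α) (t : ℕ) (s' : State α) : Prop :=
  ∃ t' ≤ t, Run p s t' s'

theorem Run.within {p : CounterProg α} {s s' : State α} {t : ℕ} (h : Run p s t s') :
    RunWithin p s t s' := ⟨t, le_rfl, h⟩

theorem RunWithin.mono {p : CounterProg α} {s s' : State α} {t t' : ℕ} (h : RunWithin p s t s')
    (ht : t ≤ t') : RunWithin p s t' s' :=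
  let ⟨u, hu, hr⟩ := h
  ⟨u, hu.trans ht, hr⟩

theorem RunWithin.seq {p q : CounterProg α} {s s' s'' : State α} {t t' : ℕ}
    (h : RunWithin p s t s') (h' : RunWithin q s' t' s'') :
    RunWithin (seq p q) s (t + t') s'' :=
  let ⟨u, hu, hr⟩ := h
  let ⟨u', hu', hr'⟩ := h'
  ⟨u + u', add_le_add hu hu', hr.seq hr'⟩

/-- `S i` plays the role of a loop invariant: the state when `i` rounds remain. Each round costs one
more step for the test, and so does the exit. -/
theorem RunWithin.loop {p : CounterProg α} {r t : ℕ} (S : ℕ → State α) (hS : ∀ i, (S i).reg r = i)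
    (n : ℕ) (h : ∀ i < n, RunWithin p
      ⟨(S (i + 1)).left, (S (i + 1)).right, update (S (i + 1)).reg r i⟩ t (S i)) :
    RunWithin (loop r p) (S n) (n * (t + 1) + 1) (S 0) := by
  induction n with
  | zero => exact ⟨1, by simp, Run.loop_zero (hS 0)⟩
  | succ n ih =>
    obtain ⟨u, hu, hr⟩ := h n (Nat.lt_succ_self n)
    obtain ⟨u', hu', hr'⟩ := ih (fun i hi => h i (Nat.lt_succ_of_lt hi))
    refine ⟨1 + u + u', by nlinarith, Run.loop_succ (by rw [hS]; simp) ?_ hr'⟩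
    rw [hS]
    exact hr

theorem runWithin_inc {r : ℕ} {l x : List α} {g g' : ℕ → ℕ} (h : g' = update g r (g r + 1)) :
    RunWithin (inc r) ⟨l, x, g⟩ 1 ⟨l, x, g'⟩ :=
  h ▸ (Run.inc r l x g).within

theorem runWithin_dec {r : ℕ} {l x : List α} {g g' : ℕ → ℕ} (h : g' = update g r (g r - 1)) :
    RunWithin (dec r) ⟨l, x, g⟩ 1 ⟨l, x, g'⟩ :=
  h ▸ (Run.dec r l x g).within

theorem runWithin_transfer {r q : ℕ} (hrq : r ≠ q) (l x : List α) (g : ℕ → ℕ) :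
    RunWithin (loop r (inc q)) ⟨l, x, g⟩ (2 * g r + 1)
      ⟨l, x, update (update g r 0) q (g q + g r)⟩ := by
  have := RunWithin.loop (p := inc q) (r := r) (t := 1)
    (fun i => ⟨l, x, update (update g r i) q (g q + (g r - i))⟩)
    (by intro i; simp [hrq]) (g r) (by
      intro i hi
      refine runWithin_inc ?_
      funext j
      simp only [update_apply]
      grind)
  refine RunWithin.mono ?_ (show g r * (1 + 1) + 1 ≤ _ by omega)
  simpa using this

theorem run_rewind (l x : List α) (g : ℕ → ℕ) :
    Run rewind ⟨l, x, g⟩ (l.length + 1) ⟨[], l.reverse ++ x, g⟩ := by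
  induction l generalizing x with
  | nil => exact Run.rewind_nil x g
  | cons a l ih =>
    rw [List.length_cons, Nat.add_comm (l.length + 1)]
    simpa using Run.rewind_cons (ih (a :: x))

theorem run_scan (r : ℕ) (l x : List α) (g : ℕ → ℕ) :
    Run (scan r) ⟨l, x, g⟩ (x.length + 1) ⟨x.reverse ++ l, [], update g r (g r + x.length)⟩ := by
  induction x generalizing l g with
  | nil => simpa using Run.scan_nil r l g
  | cons a x ih =>
    rw [List.length_cons, Nat.add_comm (x.length + 1)]
    have := Run.scan_cons (ih (a :: l) (update g r (g r + 1)))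
    simpa [add_assoc, add_comm 1] using this

theorem runWithin_rights (r : ℕ) (x : List α) (g : ℕ → ℕ) :
    RunWithin (loop r right) ⟨[], x, g⟩ (2 * g r + 1)
      ⟨(x.take (g r)).reverse, x.drop (g r), update g r 0⟩ := by
  have := RunWithin.loop (p := right) (r := r) (t := 1)
    (fun i => ⟨(x.take (g r - i)).reverse, x.drop (g r - i), update g r i⟩)
    (by intro i; simp) (g r) (by
      intro i hi
      obtain ⟨m, hm⟩ : ∃ m, g r = m + 1 + i := ⟨g r - 1 - i, by omega⟩
      have e1 : g r - i = m + 1 := by omega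
      have e2 : g r - (i + 1) = m := by omega
      simp only [e1, e2, update_idem]
      rcases lt_or_ge m x.length with h | h
      · rw [List.drop_eq_getElem_cons h, List.take_succ_eq_append_getElem h]
        rw [List.reverse_append]
        exact (Run.right_cons ..).within
      -- At the end of the input the head stays put, just as `take` and `drop` become stationary.
      · rw [List.drop_eq_nil_of_le h, List.drop_eq_nil_of_le (by omega),
          List.take_of_length_le h, List.take_of_length_le (by omega)]
        exact (Run.right_nil ..).within)
  refine RunWithin.mono ?_ (show g r * (1 + 1) + 1 ≤ _ by omega)
  simpa using this

end CounterProg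

/-- A type of contexts: each context consists of an input string and the values of variables. -/
class InputContext (α : outParam Type) (A : Type) where
  Var : Type
  input : A → List α
  val : Var → A → ℕ

namespace InputContext

variable {α : Type}

instance : InputContext α (List α) where
  Var := Empty
  input x := x
  val := Empty.elim

/-- The new variable `none` is the bound index of a sum or a quantifier. -/
instance (A : Type) [InputContext α A] : InputContext α (A × ℕ) where
  Var := Option (Var A)
  input a := input a.1
  val i a := i.elim a.2 (fun j => val j a.1)

end InputContext

open InputContext CounterProg Function Polynomial

/-- The function `f` of contexts is computable by a counter program, with polynomial bounds on the
value and on the number of steps, whatever registers hold the variables. -/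
def PolyComputable {α A : Type} [InputContext α A] (f : A → ℕ) : Prop :=
  ∀ (ρ : Var A → ℕ) (d : ℕ), (∀ i, ρ i < d) → ∃ (p : CounterProg α) (T : ℕ[X]),
    ∀ (a : A) (g : ℕ → ℕ) (B : ℕ), (∀ r, d ≤ r → g r = 0) → (∀ i, g (ρ i) = val i a) →
      (input a).length ≤ B → (∀ i : Var A, val i a ≤ B) →
      f a ≤ T.eval B ∧
        RunWithin p ⟨[], input a, g⟩ (T.eval B) ⟨[], input a, update g d (f a)⟩

namespace PolyComputable

variable {α A : Type} [InputContext α A] {f g : A → ℕ}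

theorem zero : PolyComputable (fun _ : A => 0) := by
  intro ρ d hρ
  -- Register `d` is zero, so `dec d` changes nothing and serves as the empty program.
  refine ⟨dec d, 1, fun a g B hg _ _ _ => ⟨by simp, ?_⟩⟩
  have := (Run.dec d [] (input a) g).within
  simpa [hg d le_rfl] using this

theorem one : PolyComputable (fun _ : A => 1) := by
  intro ρ d hρ
  refine ⟨inc d, 1, fun a g B hg _ _ _ => ⟨by simp, ?_⟩⟩
  have := (Run.inc d [] (input a) g).within
  simpa [hg d le_rfl] using this

theorem length : PolyComputable (fun a : A => (input a).length) := by
  intro ρ d hρ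
  refine ⟨seq (scan d) rewind, 2 * X + 2, fun a g B hg _ hB _ => ⟨by simp; omega, ?_⟩⟩
  have := (run_scan d [] (input a) g).within.seq (run_rewind _ _ _).within
  refine RunWithin.mono (t := (input a).length + 1 + ((input a).length + 1)) ?_ (by simp; omega)
  simpa [hg d le_rfl] using this

/-- Reading a unary register in a loop empties it. It is therefore moved to `d` and `d + 1`
simultaneously and then refilled from `d + 1`. -/
theorem var (i : Var A) : PolyComputable (fun a : A => val i a) := by
  intro ρ d hρ
  refine ⟨seq (loop (ρ i) (seq (inc d) (inc (d + 1)))) (loop (d + 1) (inc (ρ i))),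
    5 * X + 2, fun a g B hg hv _ hB => ⟨by simp; linarith [hB i], ?_⟩⟩
  have hi := hρ i
  have h1 := RunWithin.loop (p := seq (inc d) (inc (d + 1))) (r := ρ i) (t := 2)
    (fun j => ⟨[], input a, update (update (update g (ρ i) j) d (val i a - j)) (d + 1)
      (val i a - j)⟩) (by
        intro j
        simp only [update_apply]
        grind) (val i a) (by
      intro j hj
      refine (runWithin_inc rfl).seq (runWithin_inc ?_) (t := 1) (t' := 1)
      funext k
      simp only [update_apply]
      grind)
  have h2 := h1.seq (runWithin_transfer (r := d + 1) (q := ρ i) (by omega) _ _ _)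
  refine RunWithin.mono (t := val i a * (2 + 1) + 1 + (2 * val i a + 1)) ?_ ?_
  · convert h2 using 1
    · congr 1
      funext k
      simp only [update_apply]
      grind
    · simp only [update_apply]
      grind
    · congr 1
      funext k
      simp only [update_apply]
      grind
  · simp
    linarith [hB i]

/-- The registers work like a stack: a result goes to `d`, and everything above is zero before and
after. The second operand is thus computed at `d + 1`, with `d` occupied. -/
theorem add (hf : PolyComputable f) (hg : PolyComputable g) :
    PolyComputable (fun a => f a + g a) := by
  intro ρ d hρ
  obtain ⟨p, T, hp⟩ := hf ρ d hρ
  obtain ⟨q, U, hq⟩ := hg ρ (d + 1) (fun i => (hρ i).trans (Nat.lt_succ_self d))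
  refine ⟨seq p (seq q (loop (d + 1) (inc d))), T + 3 * U + 1, fun a r B hr hv hl hB => ?_⟩
  obtain ⟨hf', hp'⟩ := hp a r B hr hv hl hB
  obtain ⟨hg', hq'⟩ := hq a (update r d (f a)) B
    (fun j hj => by rw [update_of_ne (by omega)]; exact hr j (by omega))
    (fun i => by rw [update_of_ne (hρ i).ne]; exact hv i) hl hB
  refine ⟨by simp; omega, ?_⟩
  have h := hp'.seq (hq'.seq (runWithin_transfer (r := d + 1) (q := d) (by omega) _ _ _))
  refine RunWithin.mono (t := T.eval B + (U.eval B + (2 * g a + 1))) ?_ (by simp; omega)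
  convert h using 1
  · simp
  · congr 1
    have := hr (d + 1) (by omega)
    funext k
    simp only [update_apply]
    grind

theorem sub (hf : PolyComputable f) (hg : PolyComputable g) :
    PolyComputable (fun a => f a - g a) := by
  intro ρ d hρ
  obtain ⟨p, T, hp⟩ := hf ρ d hρ
  obtain ⟨q, U, hq⟩ := hg ρ (d + 1) (fun i => (hρ i).trans (Nat.lt_succ_self d))
  refine ⟨seq p (seq q (loop (d + 1) (dec d))), T + 3 * U + 1, fun a r B hr hv hl hB => ?_⟩
  obtain ⟨hf', hp'⟩ := hp a r B hr hv hl hB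
  obtain ⟨hg', hq'⟩ := hq a (update r d (f a)) B
    (fun j hj => by rw [update_of_ne (by omega)]; exact hr j (by omega))
    (fun i => by rw [update_of_ne (hρ i).ne]; exact hv i) hl hB
  refine ⟨by simp; omega, ?_⟩
  have h1 := RunWithin.loop (p := dec d) (r := d + 1) (t := 1)
    (fun j => ⟨[], input a, update (update r d (f a - (g a - j))) (d + 1) j⟩) (by simp) (g a) (by
      intro j hj
      refine runWithin_dec ?_
      funext k
      simp only [update_apply]
      grind)
  have h := hp'.seq (hq'.seq (cast (by simp; rfl) h1))
  refine RunWithin.mono (t := T.eval B + (U.eval B + (g a * (1 + 1) + 1))) ?_ (by simp; omega)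
  convert h using 1
  congr 1
  have := hr (d + 1) (by omega)
  funext k
  simp only [update_apply]
  grind

open Classical in
theorem symbol (c : α) (hf : PolyComputable f) :
    PolyComputable (fun a => if (input a)[f a]? = some c then 1 else 0) := by
  intro ρ d hρ
  obtain ⟨p, T, hp⟩ := hf ρ (d + 1) (fun i => (hρ i).trans (Nat.lt_succ_self d))
  refine ⟨seq p (seq (loop (d + 1) right) (seq (probe c d) rewind)), 3 * T + X + 3,
    fun a r B hr hv hl hB => ?_⟩
  obtain ⟨hf', hp'⟩ := hp a r B (fun j hj => hr j (by omega)) hv hl hB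
  refine ⟨by simp; split_ifs <;> omega, ?_⟩
  have h := hp'.seq ((runWithin_rights (d + 1) (input a) _).seq
    ((Run.probe c d _ _ _).within.seq (run_rewind _ _ _).within))
  refine RunWithin.mono (t := T.eval B + (2 * f a + 1 + (1 + ((input a).length + 1)))) ?_
    (by simp; omega)
  refine RunWithin.mono (t := T.eval B + (2 * f a + 1 + (1 + (min (f a) (input a).length + 1)))) ?_
    (by omega)
  convert h using 1
  · simp
  · have := hr (d + 1) (by omega)
    have := hr d (by omega)
    congr 1
    · simp
    · funext k
      simp only [update_apply, List.head?_drop]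
      grind

/-- The loop counter `d + 1` is also the summation index: inside the body it takes the values `f a -
1, …, 0`. When it equals `j` after a round, `d` holds the sum over `Ico j (f a)`. -/
theorem sum {h : A → ℕ → ℕ} (hf : PolyComputable f)
    (hh : PolyComputable (fun a : A × ℕ => h a.1 a.2)) :
    PolyComputable (fun a => ∑ i ∈ Finset.range (f a), h a i) := by
  intro ρ d hρ
  obtain ⟨p, T, hp⟩ := hf ρ (d + 1) (fun i => (hρ i).trans (Nat.lt_succ_self d))
  obtain ⟨q, U, hq⟩ := hh (fun o => Option.elim o (d + 1) ρ) (d + 2) (by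
    rintro (_ | i)
    · exact Nat.lt_succ_self _
    · exact (hρ i).trans (by omega))
  -- The index is below `f a`, hence below the value of `T`, so `X + T` bounds every variable of the
  -- body; this explains `U.comp (X + T)`.
  refine ⟨seq p (loop (d + 1) (seq q (loop (d + 2) (inc d)))),
    T + (T * (3 * U.comp (X + T) + 2) + 1), fun a r B hr hv hl hB => ?_⟩
  obtain ⟨hf', hp'⟩ := hp a r B (fun j hj => hr j (by omega)) hv hl hB
  set u := U.eval (B + T.eval B) with hu
  have key : ∀ i < f a, ∀ r' : ℕ → ℕ, (∀ j, d + 2 ≤ j → r' j = 0) → (∀ j < d, r' j = r j) →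
      r' (d + 1) = i → h a i ≤ u ∧ RunWithin q ⟨[], input a, r'⟩ u
        ⟨[], input a, update r' (d + 2) (h a i)⟩ := by
    intro i hi r' hr' hr'' hi'
    refine hq (a, i) r' (B + T.eval B) hr' ?_ (hl.trans (by omega)) ?_
    · rintro (_ | j)
      · exact hi'
      · exact (hr'' _ (hρ j)).trans (hv j)
    · rintro (_ | j)
      · exact (show i ≤ _ by omega)
      · exact (hB j).trans (by omega)
  have hT : T.eval B * (3 * u + 2) + 1 + T.eval B =
      (T + (T * (3 * U.comp (X + T) + 2) + 1)).eval B := by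
    simp [hu]; ring
  rw [← hT]
  -- The bound on the values comes together with a run, so some admissible register contents have to
  -- be supplied.
  have hle : ∀ i < f a, h a i ≤ u := fun i hi =>
    (key i hi (fun j => if j < d then r j else if j = d + 1 then i else 0)
      (fun j hj => by rw [if_neg (by omega), if_neg (by omega)])
      (fun j hj => by simp [hj]) (by simp)).1
  constructor
  · calc ∑ i ∈ Finset.range (f a), h a i ≤ ∑ i ∈ Finset.range (f a), u :=
        Finset.sum_le_sum fun i hi => hle i (Finset.mem_range.1 hi)
      _ = f a * u := by simp
      _ ≤ T.eval B * u := Nat.mul_le_mul_right _ hf'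
      _ ≤ _ := by nlinarith
  · have h1 := RunWithin.loop (p := seq q (loop (d + 2) (inc d))) (r := d + 1) (t := 3 * u + 1)
      (fun j => ⟨[], input a, update (update r d (∑ i ∈ Finset.Ico j (f a), h a i)) (d + 1) j⟩)
      (by simp) (f a) (by
        intro j hj
        obtain ⟨hv, hrun⟩ := key j hj
          (update (update r d (∑ i ∈ Finset.Ico (j + 1) (f a), h a i)) (d + 1) j)
          (fun k hk => by
            rw [update_of_ne (by omega), update_of_ne (by omega)]; exact hr k (by omega))
          (fun k hk => by
            rw [update_of_ne (by omega), update_of_ne (by omega)]) (by simp)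
        have h2 := hrun.seq (runWithin_transfer (r := d + 2) (q := d) (by omega) _ _ _)
        refine RunWithin.mono (t := u + (2 * h a j + 1)) ?_ (by omega)
        convert h2 using 1
        · simp
        · simp
        · congr 1
          rw [Finset.sum_eq_sum_Ico_succ_bot hj]
          have := hr (d + 2) (by omega)
          funext k
          simp only [update_apply]
          grind)
    refine RunWithin.mono (hp'.seq (t' := f a * (3 * u + 1 + 1) + 1)
      (s'' := ⟨[], input a, update r d (∑ i ∈ Finset.range (f a), h a i)⟩) ?_) ?_
    · have := hr (d + 1) (by omega)
      have := hr d (by omega)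
      convert h1 using 1
      · congr 1
        funext k
        simp only [update_apply, Finset.Ico_self, Finset.sum_empty]
        grind
      · congr 1
        rw [Finset.range_eq_Ico]
        funext k
        simp only [update_apply]
        grind
    · nlinarith

theorem fst (hf : PolyComputable f) : PolyComputable (fun a : A × ℕ => f a.1) := by
  intro ρ d hρ
  obtain ⟨p, T, hp⟩ := hf (fun i => ρ (some i)) d (fun i => hρ _)
  exact ⟨p, T, fun a g B hg hv hl hB =>
    hp a.1 g B hg (fun i => hv (some i)) hl (fun i => hB (some i))⟩

theorem snd : PolyComputable (fun a : A × ℕ => a.2) := var (A := A × ℕ) none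

end PolyComputable

/-! ### Closure under arithmetic, logic and bounded quantifiers -/

open InputContext CounterProg Function Polynomial

open Classical in
/-- The truth value of a proposition as a number. -/
noncomputable def truthVal (P : Prop) : ℕ := if P then 1 else 0

theorem truthVal_of_true {P : Prop} (h : P) : truthVal P = 1 := if_pos h

theorem truthVal_of_false {P : Prop} (h : ¬P) : truthVal P = 0 := if_neg h

/-- `b ^ e` if `e < B`, and `0` otherwise. -/
def cappedPow (B b e : ℕ) : ℕ := if e < B then b ^ e else 0

theorem cappedPow_of_lt {B b e : ℕ} (h : e < B) : cappedPow B b e = b ^ e := if_pos h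

/-- The predicate `P` of contexts is decidable by a counter program in polynomial time. -/
def PolyDecidable {α A : Type} [InputContext α A] (P : A → Prop) : Prop :=
  PolyComputable (fun a => truthVal (P a))

section closure

variable {α A : Type} [InputContext α A] {f g : A → ℕ} {P Q : A → Prop}

theorem PolyComputable.congr (hf : PolyComputable f) (h : ∀ a, g a = f a) : PolyComputable g := by
  rwa [show g = f from funext h]

theorem PolyComputable.const (c : ℕ) : PolyComputable (fun _ : A => c) := by
  induction c with
  | zero => exact .zero
  | succ c ih => exact ih.add .one

theorem PolyComputable.mul (hf : PolyComputable f) (hg : PolyComputable g) :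
    PolyComputable (fun a => f a * g a) :=
  (hf.sum (h := fun a _ => g a) hg.fst).congr fun a => by simp

theorem PolyDecidable.lt (hf : PolyComputable f) (hg : PolyComputable g) :
    PolyDecidable (fun a => f a < g a) :=
  -- With truncated subtraction, `1 - (1 - (g a - f a))` is `1` if `f a < g a` and `0` otherwise.
  (PolyComputable.one.sub (PolyComputable.one.sub (hg.sub hf))).congr fun a => by
    unfold truthVal; split_ifs <;> omega

theorem PolyDecidable.not (hP : PolyDecidable P) : PolyDecidable (fun a => ¬P a) :=
  (PolyComputable.one.sub hP).congr fun a => by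
    by_cases h : P a <;> simp [truthVal, h]

theorem PolyDecidable.of_iff (hP : PolyDecidable P) (h : ∀ a, Q a ↔ P a) : PolyDecidable Q := by
  rwa [show Q = P from funext fun a => propext (h a)]

theorem PolyDecidable.and (hP : PolyDecidable P) (hQ : PolyDecidable Q) :
    PolyDecidable (fun a => P a ∧ Q a) :=
  (PolyComputable.mul hP hQ).congr fun a => by
    by_cases h : P a <;> by_cases h' : Q a <;> simp [truthVal, h, h']

theorem PolyDecidable.imp (hP : PolyDecidable P) (hQ : PolyDecidable Q) :
    PolyDecidable (fun a => P a → Q a) :=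
  (hP.and hQ.not).not.of_iff fun a => by simp

theorem PolyDecidable.iff (hP : PolyDecidable P) (hQ : PolyDecidable Q) :
    PolyDecidable (fun a => (P a ↔ Q a)) :=
  ((hP.imp hQ).and (hQ.imp hP)).of_iff fun _ => iff_iff_implies_and_implies

theorem PolyDecidable.le (hf : PolyComputable f) (hg : PolyComputable g) :
    PolyDecidable (fun a => f a ≤ g a) :=
  (PolyDecidable.lt hg hf).not.of_iff fun _ => not_lt.symm

theorem PolyDecidable.eq (hf : PolyComputable f) (hg : PolyComputable g) :
    PolyDecidable (fun a => f a = g a) :=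
  ((PolyDecidable.le hf hg).and (PolyDecidable.le hg hf)).of_iff fun _ => le_antisymm_iff

/-- The number of counterexamples is a bounded sum, to be compared with zero. -/
theorem PolyDecidable.forall_lt {R : A → ℕ → Prop} (hf : PolyComputable f)
    (hR : PolyDecidable (fun a : A × ℕ => R a.1 a.2)) :
    PolyDecidable (fun a => ∀ i < f a, R a i) :=
  (PolyDecidable.eq (hf.sum (h := fun a i => truthVal (¬R a i)) hR.not) .zero).of_iff fun a => by
    simp [truthVal, Finset.sum_eq_zero_iff]

theorem PolyDecidable.symbol (c : α) (hf : PolyComputable f) :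
    PolyDecidable (fun a => (input a)[f a]? = some c) :=
  (PolyComputable.symbol c hf).congr fun a => by unfold truthVal; split_ifs <;> rfl

/-- The quotient is the number of `i < f a` with `(i + 1) * g a ≤ f a`; the condition `0 < g a`
yields the conventional value `0` for division by zero. -/
theorem PolyComputable.div (hf : PolyComputable f) (hg : PolyComputable g) :
    PolyComputable (fun a => f a / g a) := by
  refine (hf.sum (h := fun a i => truthVal (0 < g a ∧ (i + 1) * g a ≤ f a))
    (PolyDecidable.and (.lt .zero hg.fst) (.le ((snd.add .one).mul hg.fst) hf.fst))).congr
    fun a => ?_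
  rcases Nat.eq_zero_or_pos (g a) with h | h
  · simp [h, truthVal]
  · have h1 : ∀ i, (0 < g a ∧ (i + 1) * g a ≤ f a) ↔ i < f a / g a := fun i => by
      rw [← Nat.le_div_iff_mul_le h]
      exact ⟨fun h => h.2, fun h' => ⟨h, h'⟩⟩
    simp only [h1, truthVal]
    rw [Finset.sum_boole, show (Finset.range (f a)).filter (· < f a / g a) =
      Finset.range (f a / g a) from ?_, Finset.card_range, Nat.cast_id]
    ext i
    have := Nat.div_le_self (f a) (g a)
    simp
    omega

theorem PolyComputable.mod (hf : PolyComputable f) (hg : PolyComputable g) :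
    PolyComputable (fun a => f a % g a) :=
  (hf.sub (hg.mul (hf.div hg))).congr fun _ => Nat.mod_eq_sub_mul_div

theorem PolyComputable.pow_const (hf : PolyComputable f) (c : ℕ) :
    PolyComputable (fun a => f a ^ c) := by
  induction c with
  | zero => exact PolyComputable.one.congr fun a => pow_zero _
  | succ c ih => exact (ih.mul hf).congr fun a => pow_succ _ _

/-- A variable exponent would break the polynomial bound on values. Below a constant cap only
finitely many fixed powers occur, and each contributes one term. -/
theorem PolyComputable.cappedPow (B : ℕ) (hf : PolyComputable f) (hg : PolyComputable g) :
    PolyComputable (fun a => cappedPow B (f a) (g a)) := by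
  induction B with
  | zero => exact PolyComputable.zero.congr fun a => by simp [_root_.cappedPow]
  | succ B ih =>
    refine (ih.add (PolyComputable.mul (PolyDecidable.eq hg (.const B)) (hf.pow_const B))).congr
      fun a => ?_
    unfold _root_.cappedPow truthVal
    by_cases h : g a = B
    · simp [h]
    · simp [h, show g a < B + 1 ↔ g a < B by omega]

end closure

theorem PolyDecidable.decidableInPolyTime {α A : Type} [Fintype α] [Inhabited α]
    {P : List α → Prop} (hP : PolyDecidable P) {enc : A → List α} {Q : A → Prop}
    (h : ∀ a, Q a ↔ P (enc a)) : DecidableInPolyTime enc Q := by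
  obtain rfl : Q = fun a => P (enc a) := funext fun a => propext (h a)
  -- A bare string has no variables, so `d = 0` is allowed and the result lands in the register that
  -- the machine outputs.
  obtain ⟨p, T, hp⟩ := hP Empty.elim 0 (fun i => i.elim)
  refine CounterProg.decidableInPolyTime_of_run p T fun a => ?_
  obtain ⟨t, ht, hr⟩ := (hp (enc a) 0 _ (fun _ _ => rfl) (fun i => i.elim) le_rfl
    (fun i => i.elim)).2
  exact ⟨t, ht, hr⟩

/-! ### The decision procedure on strings -/

namespace EquivString

variable (B : ℕ) (x : List (Option Bool))

/-- The number of end markers among the first `p` symbols. -/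
noncomputable def markers (p : ℕ) : ℕ :=
  ∑ q ∈ Finset.range p, truthVal (x[q]? = some none)

/-- The position at which the `j`-th bit string starts. -/
noncomputable def fieldStart (j : ℕ) : ℕ :=
  ∑ p ∈ Finset.range x.length, truthVal (markers x p < j)

/-- Bit `w` of the `j`-th bit string is `1`. -/
def fieldBit (j w : ℕ) : Prop := x[fieldStart x j + w]? = some (some true)

/-- The number of nodes. -/
noncomputable def nodeCount : ℕ := fieldStart x 1 - 1

/-- The number of layers of the first system. -/
noncomputable def layerCount₀ : ℕ := fieldStart x 2 - fieldStart x 1 - 1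

/-- The number of layers of the second system. -/
noncomputable def layerCount₁ : ℕ := fieldStart x 3 - fieldStart x 2 - 1

/-- The number of layers of both systems. -/
noncomputable def layerCount : ℕ := layerCount₀ x + layerCount₁ x

/-- The first bit string that describes the node `v`. -/
noncomputable def nodeStart (v : ℕ) : ℕ := 3 + v * (2 * layerCount x + 2)

/-- The index of the bit string with the neighborhood of the node `v` in layer `i`, where the
layers of the second system come after those of the first. -/
noncomputable def layerField (v i : ℕ) : ℕ :=
  nodeStart x v + 2 * i + truthVal (layerCount₀ x ≤ i)

/-- The number whose binary digits tell to which neighborhoods of `v` the node `w` belongs. -/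
noncomputable def nodeType (v w : ℕ) : ℕ :=
  ∑ i ∈ Finset.range (layerCount x), truthVal (fieldBit x (layerField x v i) w) * cappedPow B 2 i

/-- The number of types. -/
noncomputable def typeCount : ℕ := cappedPow B 2 (layerCount x)

/-- The number of nodes of type `t`. -/
noncomputable def classSize (v t : ℕ) : ℕ :=
  ∑ w ∈ Finset.range (nodeCount x), truthVal (nodeType B x v w = t)

/-- Entry `t` of the profile that is encoded by `y`. -/
noncomputable def profileEntry (y t : ℕ) : ℕ :=
  y / cappedPow B (nodeCount x + 1) t % (nodeCount x + 1)

/-- The number of ones that the profile encoded by `y` has in a neighborhood. -/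
noncomputable def onesCount (y i : ℕ) : ℕ :=
  ∑ t ∈ Finset.range (typeCount B x), truthVal (t / cappedPow B 2 i % 2 = 1) * profileEntry B x y t

/-- The next state of a node whose description starts with the `o`-th bit string, for a system with
`k` layers, when the neighborhood in layer `i` has `onesCount y (s + i)` ones. -/
def nextState (o k s y : ℕ) : Prop :=
  fieldBit x (o + 2 * k) (∑ i ∈ Finset.range k,
    truthVal (fieldBit x (o + 2 * i + 1) (onesCount B x y (s + i))) * cappedPow B 2 i)

/-- The two systems described by `x` agree on all profiles at all nodes. -/
def Agree : Prop :=
  ∀ v < nodeCount x, ∀ y < cappedPow B (nodeCount x + 1) (typeCount B x),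
    (∀ t < typeCount B x, profileEntry B x y t ≤ classSize B x v t) →
      (nextState B x (nodeStart x v) (layerCount₀ x) 0 y ↔
        nextState B x (nodeStart x v + (2 * layerCount₀ x + 1)) (layerCount₁ x)
          (layerCount₀ x) y)

/-! ### Polynomial-time computability of the ingredients of `Agree` -/

section closure

variable {A : Type} [InputContext (Option Bool) A] {f g h k : A → ℕ}

theorem polyComputable_markers (hf : PolyComputable f) :
    PolyComputable (fun a => markers (input a) (f a)) :=
  hf.sum (PolyDecidable.symbol (A := A × ℕ) none .snd)

theorem polyComputable_fieldStart (hf : PolyComputable f) :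
    PolyComputable (fun a => fieldStart (input a) (f a)) :=
  PolyComputable.length.sum
    (PolyDecidable.lt (A := A × ℕ) (polyComputable_markers .snd) hf.fst)

theorem polyDecidable_fieldBit (hf : PolyComputable f) (hg : PolyComputable g) :
    PolyDecidable (fun a => fieldBit (input a) (f a) (g a)) :=
  PolyDecidable.symbol _ ((polyComputable_fieldStart hf).add hg)

theorem polyComputable_nodeCount : PolyComputable (fun a : A => nodeCount (input a)) :=
  (polyComputable_fieldStart (.const 1)).sub .one

theorem polyComputable_layerCount₀ : PolyComputable (fun a : A => layerCount₀ (input a)) :=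
  ((polyComputable_fieldStart (.const 2)).sub (polyComputable_fieldStart (.const 1))).sub .one

theorem polyComputable_layerCount₁ : PolyComputable (fun a : A => layerCount₁ (input a)) :=
  ((polyComputable_fieldStart (.const 3)).sub (polyComputable_fieldStart (.const 2))).sub .one

theorem polyComputable_layerCount : PolyComputable (fun a : A => layerCount (input a)) :=
  polyComputable_layerCount₀.add polyComputable_layerCount₁

theorem polyComputable_nodeStart (hf : PolyComputable f) :
    PolyComputable (fun a => nodeStart (input a) (f a)) :=
  (PolyComputable.const 3).add
    (hf.mul (((PolyComputable.const 2).mul polyComputable_layerCount).add (.const 2)))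

theorem polyComputable_layerField (hf : PolyComputable f) (hg : PolyComputable g) :
    PolyComputable (fun a => layerField (input a) (f a) (g a)) :=
  ((polyComputable_nodeStart hf).add ((PolyComputable.const 2).mul hg)).add
    (PolyDecidable.le polyComputable_layerCount₀ hg)

theorem polyComputable_nodeType (hf : PolyComputable f) (hg : PolyComputable g) :
    PolyComputable (fun a => nodeType B (input a) (f a) (g a)) :=
  polyComputable_layerCount.sum (PolyComputable.mul (A := A × ℕ)
    (polyDecidable_fieldBit (polyComputable_layerField hf.fst .snd) hg.fst)
    (.cappedPow B (.const 2) .snd))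

theorem polyComputable_typeCount : PolyComputable (fun a : A => typeCount B (input a)) :=
  .cappedPow B (.const 2) polyComputable_layerCount

theorem polyComputable_classSize (hf : PolyComputable f) (hg : PolyComputable g) :
    PolyComputable (fun a => classSize B (input a) (f a) (g a)) :=
  polyComputable_nodeCount.sum
    (PolyDecidable.eq (A := A × ℕ) (polyComputable_nodeType B hf.fst .snd) hg.fst)

theorem polyComputable_profileEntry (hf : PolyComputable f) (hg : PolyComputable g) :
    PolyComputable (fun a => profileEntry B (input a) (f a) (g a)) :=
  (hf.div (.cappedPow B (polyComputable_nodeCount.add .one) hg)).mod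
    (polyComputable_nodeCount.add .one)

theorem polyComputable_onesCount (hf : PolyComputable f) (hg : PolyComputable g) :
    PolyComputable (fun a => onesCount B (input a) (f a) (g a)) :=
  (polyComputable_typeCount B).sum (PolyComputable.mul (A := A × ℕ)
    (PolyDecidable.eq ((PolyComputable.div .snd (.cappedPow B (.const 2) hg.fst)).mod (.const 2))
      .one) (polyComputable_profileEntry B hf.fst .snd))

theorem polyDecidable_nextState (hf : PolyComputable f) (hg : PolyComputable g)
    (hh : PolyComputable h) (hk : PolyComputable k) :
    PolyDecidable (fun a => nextState B (input a) (f a) (g a) (h a) (k a)) :=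
  polyDecidable_fieldBit (hf.add ((PolyComputable.const 2).mul hg))
    (hg.sum (PolyComputable.mul (A := A × ℕ) (polyDecidable_fieldBit
      ((hf.fst.add ((PolyComputable.const 2).mul .snd)).add .one)
      (polyComputable_onesCount B hk.fst (hh.fst.add .snd))) (.cappedPow B (.const 2) .snd)))

/-- Each quantifier adds a variable to the context: `snd` is the innermost one, and every `.fst`
reaches one level further out. -/
theorem polyDecidable_agree : PolyDecidable (Agree B) := by
  refine PolyDecidable.forall_lt polyComputable_nodeCount
    (PolyDecidable.forall_lt (A := List (Option Bool) × ℕ)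
      (.cappedPow B (polyComputable_nodeCount.add .one) (polyComputable_typeCount B))
      (PolyDecidable.imp (A := (List (Option Bool) × ℕ) × ℕ)
        (PolyDecidable.forall_lt (polyComputable_typeCount B)
          (PolyDecidable.le (A := ((List (Option Bool) × ℕ) × ℕ) × ℕ)
            (polyComputable_profileEntry B PolyComputable.snd.fst .snd)
            (polyComputable_classSize B PolyComputable.snd.fst.fst .snd)))
        (PolyDecidable.iff
          (polyDecidable_nextState B (polyComputable_nodeStart PolyComputable.snd.fst)
            polyComputable_layerCount₀ .zero .snd)
          (polyDecidable_nextState B ((polyComputable_nodeStart PolyComputable.snd.fst).add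
            (((PolyComputable.const 2).mul polyComputable_layerCount₀).add .one))
            polyComputable_layerCount₁ polyComputable_layerCount₀ .snd))))

end closure

end EquivString

/-! ### Successor functions and evaluation of symmetry tables -/

theorem MSyDS.equivalent_iff {V : Type*} {k k' : ℕ} (S : MSyDS V k) (S' : MSyDS V k') :
    S.Equivalent S' ↔ ∀ C v, S.succ C v = S'.succ C v := by
  constructor
  · intro h C v
    have h1 : S'.phaseSpace.Adj C (S.succ C) := by
      rw [← show S.phaseSpace = S'.phaseSpace from h]
      exact rfl
    exact congrFun (show S.succ C = S'.succ C from h1) v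
  · intro h
    have : S.succ = S'.succ := funext fun C => funext (h C)
    simp only [MSyDS.Equivalent, MSyDS.phaseSpace, this]

open Classical in
/-- A symmetric function can be evaluated by its symmetry table. -/
theorem symmetryTable_getElem? {ι : Type*} [Finite ι] {f : (ι → Bool) → Bool}
    (hf : IsSymmetricFn f) (z : ι → Bool) : (symmetryTable f)[numOnes z]? = some (f z) := by
  have hz : numOnes z < Nat.card ι + 1 := Nat.lt_succ_of_le (Set.ncard_le_card _)
  simp only [symmetryTable, List.getElem?_map, List.getElem?_range hz, Option.map_some,
    Option.some.injEq]
  by_cases h : f z = true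
  · rw [h, decide_eq_true_iff]
    exact ⟨z, rfl, h⟩
  · rw [Bool.eq_false_of_not_eq_true h, decide_eq_false_iff_not]
    rintro ⟨y, hy, hy'⟩
    exact h (hf y z hy ▸ hy')

theorem numOnes_restrict {V : Type*} (s : Set V) (C : V → Bool) :
    numOnes (fun w : s => C w) = {w | w ∈ s ∧ C w = true}.ncard := by
  rw [numOnes, ← Set.ncard_image_of_injective _ Subtype.val_injective]
  congr 1
  ext w
  simp [and_comm]

/-! ### Binary digits -/

theorem sum_truthVal_lt (P : ℕ → Prop) (k : ℕ) :
    ∑ i ∈ Finset.range k, truthVal (P i) * 2 ^ i < 2 ^ k := by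
  induction k with
  | zero => simp
  | succ k ih =>
    rw [Finset.sum_range_succ, pow_succ]
    by_cases h : P k <;> simp only [truthVal, h, if_true, if_false] at * <;> omega

theorem testBit_sum_truthVal (P : ℕ → Prop) {k j : ℕ} (hj : j < k) :
    (∑ i ∈ Finset.range k, truthVal (P i) * 2 ^ i).testBit j = true ↔ P j := by
  induction k with
  | zero => omega
  | succ k ih =>
    rw [Finset.sum_range_succ, add_comm, mul_comm,
      Nat.testBit_two_pow_mul_add _ (sum_truthVal_lt P k)]
    split_ifs with h
    · exact ih h
    · obtain rfl : j = k := by omega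
      by_cases hP : P j <;> simp [truthVal, hP]

/-! ### Decoding -/

theorem joinFields_append (L L' : List (List Bool)) :
    joinFields (L ++ L') = joinFields L ++ joinFields L' := by
  simp [joinFields]

theorem joinFields_cons (l : List Bool) (L : List (List Bool)) :
    joinFields (l :: L) = l.map some ++ none :: joinFields L := by
  simp [joinFields]

theorem count_none_joinFields (L : List (List Bool)) :
    (joinFields L).count none = L.length := by
  induction L with
  | nil => rfl
  | cons l L ih =>
    have : (l.map some).count none = 0 := by simp [List.count_eq_zero]
    simp [joinFields_cons, ih, this]

theorem getElem?_flatMap_of_length {β γ : Type*} {f : β → List γ} {c : ℕ} {l : List β}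
    (hl : ∀ a, (f a).length = c) {v o : ℕ} {a : β} (hv : l[v]? = some a) (ho : o < c) :
    (l.flatMap f)[v * c + o]? = (f a)[o]? := by
  induction l generalizing v with
  | nil => simp at hv
  | cons b l ih =>
    rw [List.flatMap_cons]
    cases v with
    | zero =>
      obtain rfl : b = a := by simpa using hv
      rw [Nat.zero_mul, Nat.zero_add, List.getElem?_append_left (by rw [hl]; exact ho)]
    | succ v =>
      have e : (v + 1) * c + o = (f b).length + (v * c + o) := by rw [hl]; ring
      rw [e, List.getElem?_append_right (by omega), Nat.add_sub_cancel_left]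
      exact ih (by simpa using hv)

namespace EquivString

theorem markers_eq_count (x : List (Option Bool)) (p : ℕ) :
    markers x p = (x.take p).count none := by
  induction p with
  | zero => simp [markers]
  | succ p ih =>
    rw [markers, Finset.sum_range_succ, ← markers, ih]
    rcases lt_or_ge p x.length with h | h
    · rw [List.take_succ_eq_append_getElem h, List.count_append, List.getElem?_eq_getElem h]
      by_cases h' : x[p] = none <;> simp [truthVal, h']
    · rw [List.take_of_length_le h, List.take_of_length_le (by omega), List.getElem?_eq_none h]
      simp [truthVal]

/-- `joinFields L` ends with its last marker, so a prefix of the string contains fewer than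
`L.length` markers exactly if it is shorter than `joinFields L`. Counting such prefixes gives the
length. -/
theorem fieldStart_joinFields (L L' : List (List Bool)) :
    fieldStart (joinFields (L ++ L')) L.length = (joinFields L).length := by
  have key : ∀ p, markers (joinFields (L ++ L')) p < L.length ↔ p < (joinFields L).length := by
    intro p
    rw [markers_eq_count, joinFields_append]
    constructor
    · intro h
      by_contra! h'
      rw [List.take_append, List.take_of_length_le h', List.count_append,
        count_none_joinFields] at h
      omega
    · intro h
      rw [List.take_append_of_le_length h.le]
      rcases L.eq_nil_or_concat' with rfl | ⟨M, l, rfl⟩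
      · simp [joinFields] at h
      · have e : joinFields (M ++ [l]) = (joinFields M ++ l.map some) ++ [none] := by
          simp [joinFields]
        rw [e, List.length_append, List.length_singleton] at h
        rw [e, List.take_append_of_le_length (by omega)]
        refine ((List.take_sublist _ _).count_le _).trans_lt ?_
        have : (l.map some).count none = 0 := by simp [List.count_eq_zero]
        simp [count_none_joinFields, this]
  simp only [fieldStart, key, truthVal]
  rw [Finset.sum_boole, Nat.cast_id]
  rw [show (Finset.range (joinFields (L ++ L')).length).filter (· < (joinFields L).length) =
    Finset.range (joinFields L).length from ?_, Finset.card_range]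
  ext p
  simp [joinFields_append]
  omega

theorem fieldBit_joinFields {L : List (List Bool)} {j w : ℕ} {l : List Bool} {b : Bool}
    (hl : L[j]? = some l) (hw : l[w]? = some b) :
    fieldBit (joinFields L) j w ↔ b = true := by
  obtain ⟨hj, rfl⟩ := List.getElem?_eq_some_iff.1 hl
  obtain ⟨hw', rfl⟩ := List.getElem?_eq_some_iff.1 hw
  have e : L = L.take j ++ L[j] :: L.drop (j + 1) := by simp
  have hs : fieldStart (joinFields L) j = (joinFields (L.take j)).length := by
    have := fieldStart_joinFields (L.take j) (L[j] :: L.drop (j + 1))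
    rwa [← e, List.length_take_of_le hj.le] at this
  rw [fieldBit, hs]
  conv_lhs => rw [e, joinFields_append, joinFields_cons]
  rw [List.getElem?_append_right (by simp)]
  simp [List.getElem?_append_left, hw']

end EquivString

/-! ### Positions of the tables in the description of a node -/

section nodeFields

variable {n k : ℕ} (S : MSyDS (Fin n) k) (v : Fin n)

theorem MSyDS.nodeFields_getElem?_layer (i : Fin k) :
    (S.nodeFields v)[2 * (i : ℕ)]? = some (indicatorBits (closedNbhd (S.graph i) v)) ∧
    (S.nodeFields v)[2 * (i : ℕ) + 1]? = some (symmetryTable (S.localFn i v)) := by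
  have hi := i.isLt
  have hlen : ((List.finRange k).flatMap (fun i =>
      [indicatorBits (closedNbhd (S.graph i) v), symmetryTable (S.localFn i v)])).length
      = k * 2 := by
    simp [List.length_flatMap]
  have h0 : (List.finRange k)[(i : ℕ)]? = some i := by simp
  constructor
  · have := getElem?_flatMap_of_length (f := fun i =>
      [indicatorBits (closedNbhd (S.graph i) v), symmetryTable (S.localFn i v)]) (c := 2)
      (fun _ => rfl) h0 (o := 0) (by omega)
    rw [nodeFields, List.getElem?_append_left (by omega), mul_comm]
    exact this
  · have := getElem?_flatMap_of_length (f := fun i =>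
      [indicatorBits (closedNbhd (S.graph i) v), symmetryTable (S.localFn i v)]) (c := 2)
      (fun _ => rfl) h0 (o := 1) (by omega)
    rw [nodeFields, List.getElem?_append_left (by omega), mul_comm]
    exact this

theorem MSyDS.nodeFields_getElem?_master :
    (S.nodeFields v)[2 * k]? = some (truthTable (S.master v)) := by
  have hlen : ((List.finRange k).flatMap (fun i =>
      [indicatorBits (closedNbhd (S.graph i) v), symmetryTable (S.localFn i v)])).length
      = 2 * k := by
    simp [List.length_flatMap, mul_comm]
  rw [nodeFields, List.getElem?_append_right hlen.le, hlen]
  simp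

end nodeFields

/-! ### Reading the next state of a node off the string -/

namespace EquivString

/-- The description of the node `v` in the system `S` starts with the `o`-th bit string of `L`. -/
def DescribesNode (L : List (List Bool)) (o : ℕ) {n k : ℕ} (S : MSyDS (Fin n) k) (v : Fin n) :
    Prop :=
  ∀ j < 2 * k + 1, L[o + j]? = (S.nodeFields v)[j]?

variable {L : List (List Bool)} {o n k : ℕ} {S : MSyDS (Fin n) k} {v : Fin n}

open Classical in
theorem DescribesNode.fieldBit_nbhd (h : DescribesNode L o S v) (i : Fin k) (w : Fin n) :
    fieldBit (joinFields L) (o + 2 * i) w ↔ w ∈ closedNbhd (S.graph i) v := by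
  have hi := i.isLt
  rw [fieldBit_joinFields (b := decide (w ∈ closedNbhd (S.graph i) v))
    ((h (2 * i) (by omega)).trans (S.nodeFields_getElem?_layer v i).1)
    (by simp [indicatorBits])]
  simp

/-- Two table look-ups: the number of ones in a neighborhood selects the row of the symmetry table,
and the resulting local values are the binary digits of the row number in the master table. -/
theorem DescribesNode.nextState_iff (h : DescribesNode L o S v) (hS : S.SymmetricLocal)
    {B s y : ℕ} (hB : k ≤ B) {C : Fin n → Bool}
    (hc : ∀ i : Fin k, onesCount B (joinFields L) y (s + i) =
      {w | w ∈ closedNbhd (S.graph i) v ∧ C w = true}.ncard) :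
    nextState B (joinFields L) o k s y ↔ S.succ C v = true := by
  have h1 : ∀ i : Fin k, fieldBit (joinFields L) (o + 2 * i + 1)
      (onesCount B (joinFields L) y (s + i)) ↔ S.localFn i v (fun w => C w) = true := by
    intro i
    have hi := i.isLt
    rw [hc, ← numOnes_restrict, add_assoc]
    exact fieldBit_joinFields
      ((h (2 * i + 1) (by omega)).trans (S.nodeFields_getElem?_layer v i).2)
      (symmetryTable_getElem? (hS i v) _)
  rw [nextState]
  have h2 : ∀ i ∈ Finset.range k, truthVal (fieldBit (joinFields L) (o + 2 * i + 1)
      (onesCount B (joinFields L) y (s + i))) * cappedPow B 2 i =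
      truthVal (fieldBit (joinFields L) (o + 2 * i + 1)
      (onesCount B (joinFields L) y (s + i))) * 2 ^ i := fun i hi => by
    rw [cappedPow_of_lt ((Finset.mem_range.1 hi).trans_le hB)]
  rw [Finset.sum_congr rfl h2]
  refine fieldBit_joinFields ((h (2 * k) (by omega)).trans (S.nodeFields_getElem?_master v)) ?_
  simp only [truthTable, List.getElem?_map, List.getElem?_range (sum_truthVal_lt _ k),
    Option.map_some, Option.some.injEq, MSyDS.succ]
  congr 1
  funext i
  rw [Bool.eq_iff_iff, testBit_sum_truthVal _ i.isLt, h1]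

end EquivString

/-! ### Counting by type -/

section counting

variable {V β : Type*} [Fintype V]

/-- Every choice of fiber counts that do not exceed the fiber sizes is realized by a
configuration. -/
theorem exists_config_of_le_fiber [DecidableEq β] (τ : V → β) (θ : β → ℕ) (s : Set β)
    (h : ∀ t ∈ s, θ t ≤ (Finset.univ.filter (fun w => τ w = t)).card) :
    ∃ C : V → Bool, ∀ t ∈ s,
      (Finset.univ.filter (fun w => C w = true ∧ τ w = t)).card = θ t := by
  classical
  have h' : ∀ t, ∃ D : Finset V, t ∈ s →
      D ⊆ Finset.univ.filter (fun w => τ w = t) ∧ D.card = θ t := by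
    intro t
    by_cases ht : t ∈ s
    · obtain ⟨D, hD⟩ := Finset.exists_subset_card_eq (h t ht)
      exact ⟨D, fun _ => hD⟩
    · exact ⟨∅, fun h => absurd h ht⟩
  choose D hD using h'
  -- Each chosen set lies in its own fiber, so a node needs to be tested only against the set of its
  -- own type.
  refine ⟨fun w => decide (w ∈ D (τ w)), fun t ht => ?_⟩
  rw [← (hD t ht).2]
  congr 1
  ext w
  simp only [decide_eq_true_eq, Finset.mem_filter, Finset.mem_univ, true_and]
  constructor
  · rintro ⟨hw, rfl⟩
    exact hw
  · intro hw
    have : τ w = t := by simpa using (hD t ht).1 hw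
    exact ⟨this ▸ hw, this⟩

/-- A set defined by a condition on types is a union of fibers. In the application `Q` says that bit
`i` of the type is set, which describes the `i`-th neighborhood. -/
theorem sum_truthVal_mul_card_fiber (τ : V → ℕ) (M : ℕ) (hτ : ∀ w, τ w < M) (C : V → Bool)
    (Q : ℕ → Prop) :
    ∑ t ∈ Finset.range M, truthVal (Q t) *
      (Finset.univ.filter (fun w => C w = true ∧ τ w = t)).card =
      {w | Q (τ w) ∧ C w = true}.ncard := by
  classical
  rw [Set.ncard_eq_toFinset_card', Finset.card_eq_sum_card_fiberwise (f := τ)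
    (t := Finset.range M) (fun w _ => by simpa using hτ w)]
  refine Finset.sum_congr rfl fun t _ => ?_
  by_cases h : Q t
  · rw [truthVal_of_true h, one_mul]
    congr 1
    ext w
    simp only [Finset.mem_filter, Finset.mem_univ, true_and, Set.mem_toFinset, Set.mem_ofPred_eq]
    constructor
    · rintro ⟨h1, rfl⟩
      exact ⟨⟨h, h1⟩, rfl⟩
    · rintro ⟨⟨_, h1⟩, h2⟩
      exact ⟨h1, h2⟩
  · rw [truthVal_of_false h, zero_mul, eq_comm, Finset.card_eq_zero, Finset.filter_eq_empty_iff]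
    rintro w hw rfl
    simp only [Set.mem_toFinset, Set.mem_ofPred_eq] at hw
    exact h hw.1

end counting

/-- Every function with values at most `n` on `{0, …, M - 1}` is read off the digits of a number. -/
theorem exists_digits (n M : ℕ) (θ : ℕ → ℕ) (h : ∀ t < M, θ t ≤ n) :
    ∃ y < (n + 1) ^ M, ∀ t < M, y / (n + 1) ^ t % (n + 1) = θ t := by
  let e : Fin M → Fin (n + 1) := fun t => ⟨θ t, Nat.lt_succ_of_le (h t t.isLt)⟩
  -- `finFunctionFinEquiv` is the bijection between digit strings in base `n + 1` and numbers.
  refine ⟨finFunctionFinEquiv e, (finFunctionFinEquiv e).isLt, fun t ht => ?_⟩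
  have := congrArg Fin.val (congrFun (finFunctionFinEquiv.symm_apply_apply e) ⟨t, ht⟩)
  rwa [finFunctionFinEquiv_symm_apply_val] at this

/-! ### Correctness of the decision procedure on encodings -/

namespace EquivString

/-- A bound on the exponents that occur in the decision procedure for at most `K` layers. -/
def exponentBound (K : ℕ) : ℕ := 2 ^ (2 * K) + 1

variable {K : ℕ} (I : EquivInstance K)

theorem fieldStart_encode :
    fieldStart I.encode 1 = I.n + 1 ∧ fieldStart I.encode 2 = I.n + 1 + (I.k₀ + 1) ∧
      fieldStart I.encode 3 = I.n + 1 + (I.k₀ + 1) + (I.k₁ + 1) := by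
  have h1 := fieldStart_joinFields [List.replicate I.n true]
    ([List.replicate I.k₀ true, List.replicate I.k₁ true] ++
      (List.finRange I.n).flatMap (fun v => I.S₀.nodeFields v ++ I.S₁.nodeFields v))
  have h2 := fieldStart_joinFields [List.replicate I.n true, List.replicate I.k₀ true]
    ([List.replicate I.k₁ true] ++
      (List.finRange I.n).flatMap (fun v => I.S₀.nodeFields v ++ I.S₁.nodeFields v))
  have h3 := fieldStart_joinFields
    [List.replicate I.n true, List.replicate I.k₀ true, List.replicate I.k₁ true]
    ((List.finRange I.n).flatMap (fun v => I.S₀.nodeFields v ++ I.S₁.nodeFields v))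
  refine ⟨h1.trans ?_, h2.trans ?_, h3.trans ?_⟩ <;> simp [joinFields] <;> omega

theorem nodeCount_encode : nodeCount I.encode = I.n := by
  simp [nodeCount, fieldStart_encode]

theorem layerCount₀_encode : layerCount₀ I.encode = I.k₀ := by
  simp only [layerCount₀, fieldStart_encode]
  omega

theorem layerCount₁_encode : layerCount₁ I.encode = I.k₁ := by
  simp only [layerCount₁, fieldStart_encode]
  omega

theorem layerCount_encode : layerCount I.encode = I.k₀ + I.k₁ := by
  rw [layerCount, layerCount₀_encode, layerCount₁_encode]

theorem nodeStart_encode (v : ℕ) :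
    nodeStart I.encode v = 3 + v * (2 * (I.k₀ + I.k₁) + 2) := by
  rw [nodeStart, layerCount_encode]

theorem fields_getElem? (v : Fin I.n) {j : ℕ} (hj : j < 2 * (I.k₀ + I.k₁) + 2) :
    I.fields[nodeStart I.encode v + j]? = (I.S₀.nodeFields v ++ I.S₁.nodeFields v)[j]? := by
  rw [nodeStart_encode, EquivInstance.fields, add_assoc, List.getElem?_append_right (by simp)]
  rw [show 3 + (v * (2 * (I.k₀ + I.k₁) + 2) + j) - _ = v * (2 * (I.k₀ + I.k₁) + 2) + j by simp]
  refine getElem?_flatMap_of_length (fun a => ?_) (by simp) hj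
  simp only [List.length_append, MSyDS.nodeFields_length]
  ring

theorem describesNode₀ (v : Fin I.n) :
    DescribesNode I.fields (nodeStart I.encode v) I.S₀ v := by
  intro j hj
  rw [fields_getElem? I v (by omega), List.getElem?_append_left]
  rw [MSyDS.nodeFields_length]
  omega

theorem describesNode₁ (v : Fin I.n) :
    DescribesNode I.fields (nodeStart I.encode v + (2 * I.k₀ + 1)) I.S₁ v := by
  intro j hj
  have h := MSyDS.nodeFields_length I.S₀ v
  rw [add_assoc, fields_getElem? I v (by omega), List.getElem?_append_right (by omega), h]
  congr 1
  omega

/-- Equality `i = k₀ + k₁` is included because it is the exponent in `typeCount`. -/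
theorem layer_lt (I : EquivInstance K) {i : ℕ} (hi : i ≤ I.k₀ + I.k₁) : i < exponentBound K := by
  rw [exponentBound]
  have h0 := I.k₀_le
  have h1 := I.k₁_le
  have : 2 * K < 2 ^ (2 * K) := Nat.lt_two_pow_self
  omega

theorem typeCount_encode : typeCount (exponentBound K) I.encode = 2 ^ (I.k₀ + I.k₁) := by
  rw [typeCount, layerCount_encode, cappedPow_of_lt (layer_lt I le_rfl)]

/-- The number of types is itself an exponent, in the range of `y` in `Agree`; since caps are
strict, `exponentBound` carries a `+ 1`. -/
theorem two_pow_layers_lt : 2 ^ (I.k₀ + I.k₁) < exponentBound K := by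
  rw [exponentBound]
  have h0 := I.k₀_le
  have h1 := I.k₁_le
  exact Nat.lt_succ_of_le (Nat.pow_le_pow_right (by norm_num) (by omega))

theorem nodeType_encode (v w : ℕ) : nodeType (exponentBound K) I.encode v w =
    ∑ i ∈ Finset.range (I.k₀ + I.k₁),
      truthVal (fieldBit I.encode (layerField I.encode v i) w) * 2 ^ i := by
  rw [nodeType, layerCount_encode]
  refine Finset.sum_congr rfl fun i hi => ?_
  rw [cappedPow_of_lt (layer_lt I (Finset.mem_range.1 hi).le)]

theorem nodeType_lt (v w : ℕ) :
    nodeType (exponentBound K) I.encode v w < 2 ^ (I.k₀ + I.k₁) := by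
  rw [nodeType_encode]
  exact sum_truthVal_lt _ _

theorem testBit_nodeType₀ (v w : Fin I.n) (i : Fin I.k₀) :
    (nodeType (exponentBound K) I.encode v w).testBit i = true ↔
      w ∈ closedNbhd (I.S₀.graph i) v := by
  have hi := i.isLt
  rw [nodeType_encode, testBit_sum_truthVal _ (by omega), ← (describesNode₀ I v).fieldBit_nbhd,
    layerField, layerCount₀_encode, truthVal_of_false (by omega)]
  rfl

theorem testBit_nodeType₁ (v w : Fin I.n) (i : Fin I.k₁) :
    (nodeType (exponentBound K) I.encode v w).testBit (I.k₀ + i) = true ↔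
      w ∈ closedNbhd (I.S₁.graph i) v := by
  have hi := i.isLt
  rw [nodeType_encode, testBit_sum_truthVal _ (by omega), ← (describesNode₁ I v).fieldBit_nbhd,
    layerField, layerCount₀_encode, truthVal_of_true (by omega)]
  -- The extra `1` skips the truth table of the master function in the first system.
  rw [show nodeStart I.encode v + 2 * (I.k₀ + i) + 1 = nodeStart I.encode v + (2 * I.k₀ + 1) + 2 * i
    by ring]
  rfl

/-- By `hy`, the digits of `y` are the type counts of `C` at `v`; those of the types with bit `i`
set add up to the ones in neighborhood `i`. -/
theorem onesCount_encode {v : Fin I.n} {y : ℕ} {C : Fin I.n → Bool}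
    (hy : ∀ t < 2 ^ (I.k₀ + I.k₁), profileEntry (exponentBound K) I.encode y t =
      (Finset.univ.filter (fun w : Fin I.n =>
        C w = true ∧ nodeType (exponentBound K) I.encode v w = t)).card)
    {i : ℕ} (hi : i < I.k₀ + I.k₁) :
    onesCount (exponentBound K) I.encode y i = {w : Fin I.n |
      (nodeType (exponentBound K) I.encode v w).testBit i = true ∧ C w = true}.ncard := by
  rw [onesCount, typeCount_encode, ← sum_truthVal_mul_card_fiber
    (fun w : Fin I.n => nodeType (exponentBound K) I.encode v w) (2 ^ (I.k₀ + I.k₁))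
    (fun w => nodeType_lt I v w) C (fun t => t.testBit i = true)]
  refine Finset.sum_congr rfl fun t ht => ?_
  rw [hy t (Finset.mem_range.1 ht), cappedPow_of_lt (layer_lt I hi.le),
    Nat.testBit_eq_decide_div_mod_eq, decide_eq_true_iff]

theorem nextState_encode {v : Fin I.n} {y : ℕ} {C : Fin I.n → Bool}
    (hy : ∀ t < 2 ^ (I.k₀ + I.k₁), profileEntry (exponentBound K) I.encode y t =
      (Finset.univ.filter (fun w : Fin I.n =>
        C w = true ∧ nodeType (exponentBound K) I.encode v w = t)).card) :
    (nextState (exponentBound K) I.encode (nodeStart I.encode v) I.k₀ 0 y ↔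
      I.S₀.succ C v = true) ∧
    (nextState (exponentBound K) I.encode (nodeStart I.encode v + (2 * I.k₀ + 1)) I.k₁ I.k₀ y ↔
      I.S₁.succ C v = true) := by
  constructor
  · refine (describesNode₀ I v).nextState_iff I.symm₀ (layer_lt I (by omega)).le fun i => ?_
    have hi := i.isLt
    rw [Nat.zero_add]
    exact (onesCount_encode I hy (by omega)).trans (by simp only [testBit_nodeType₀])
  · refine (describesNode₁ I v).nextState_iff I.symm₁ (layer_lt I (by omega)).le fun i => ?_
    have hi := i.isLt
    exact (onesCount_encode I hy (by omega)).trans (by simp only [testBit_nodeType₁])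

theorem classSize_encode (v t : ℕ) : classSize (exponentBound K) I.encode v t =
    (Finset.univ.filter (fun w : Fin I.n =>
      nodeType (exponentBound K) I.encode v w = t)).card := by
  rw [classSize, nodeCount_encode, Finset.sum_range, Finset.card_filter]
  exact Finset.sum_congr rfl fun w _ => by unfold truthVal; split_ifs <;> rfl

theorem isYes_iff_agree : I.IsYes ↔ Agree (exponentBound K) I.encode := by
  classical
  rw [EquivInstance.IsYes, MSyDS.equivalent_iff]
  unfold Agree
  rw [nodeCount_encode, typeCount_encode, layerCount₀_encode, layerCount₁_encode,
    cappedPow_of_lt (two_pow_layers_lt I)]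
  constructor
  · intro h v hv y hy hle
    -- A feasible profile is realized by some configuration, where the two successors agree.
    obtain ⟨C, hC⟩ := exists_config_of_le_fiber
      (fun w : Fin I.n => nodeType (exponentBound K) I.encode v w)
      (profileEntry (exponentBound K) I.encode y) {t | t < 2 ^ (I.k₀ + I.k₁)}
      (fun t ht => (hle t ht).trans_eq (classSize_encode I v t))
    obtain ⟨h0, h1⟩ := nextState_encode I (v := ⟨v, hv⟩) (fun t ht => (hC t ht).symm)
    rw [← h C] at h1
    exact h0.trans h1.symm
  · intro h C v
    -- Conversely, the type counts of `C` are at most `n`, so they are the base `n + 1` digits of a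
    -- number in the tested range.
    obtain ⟨y, hy, hyC⟩ := exists_digits I.n (2 ^ (I.k₀ + I.k₁))
      (fun t => (Finset.univ.filter (fun w : Fin I.n =>
        C w = true ∧ nodeType (exponentBound K) I.encode v w = t)).card)
      (fun t _ => (Finset.card_le_univ _).trans_eq (by simp))
    have hy' : ∀ t < 2 ^ (I.k₀ + I.k₁), profileEntry (exponentBound K) I.encode y t =
        (Finset.univ.filter (fun w : Fin I.n =>
          C w = true ∧ nodeType (exponentBound K) I.encode v w = t)).card := by
      intro t ht
      rw [profileEntry, nodeCount_encode, cappedPow_of_lt (ht.trans (two_pow_layers_lt I))]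
      exact hyC t ht
    obtain ⟨h0, h1⟩ := nextState_encode I hy'
    rw [Bool.eq_iff_iff, ← h0, ← h1]
    refine h v v.isLt y hy fun t ht => ?_
    rw [hy' t ht, classSize_encode]
    exact Finset.card_le_card (Finset.monotone_filter_right _ fun w _ hw => hw.2)

end EquivString

theorem EquivInstance.decidableInPolyTime (K : ℕ) :
    DecidableInPolyTime (EquivInstance.encode : EquivInstance K → List (Option Bool))
      EquivInstance.IsYes :=
  (EquivString.polyDecidable_agree (EquivString.exponentBound K)).decidableInPolyTime
    EquivString.isYes_iff_agree

/-! ### Profiles determine the next state -/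

section profile

variable {V : Type*} [Fintype V] [DecidableEq V]

open Classical in
/-- The partition of `V` into the fibers of `τ`. -/
noncomputable def fiberPartition {β : Type*} (τ : V → β) :
    Finpartition (Finset.univ : Finset V) :=
  Finpartition.ofSetoid (Setoid.ker τ)

open Classical in
theorem mem_fiberPartition {β : Type*} (τ : V → β) {B : Finset V} :
    B ∈ (fiberPartition τ).parts ↔ ∃ a, Finset.univ.filter (fun w => τ w = τ a) = B := by
  simp only [fiberPartition, Finpartition.ofSetoid, Finpartition.ofSetSetoid, Finset.mem_image,
    Finset.mem_univ, true_and, Setoid.ker_def, eq_comm]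

-- Each block is the fiber over some element of `β`; empty fibers are not blocks, so the inequality
-- can be strict.
open Classical in
theorem card_fiberPartition_le {β : Type*} [Fintype β] (τ : V → β) :
    (fiberPartition τ).parts.card ≤ Fintype.card β := by
  have : (fiberPartition τ).parts ⊆
      (Finset.univ : Finset β).image (fun t => Finset.univ.filter (fun w => τ w = t)) := by
    intro B hB
    obtain ⟨a, rfl⟩ := (mem_fiberPartition τ).1 hB
    exact Finset.mem_image_of_mem _ (Finset.mem_univ (τ a))
  exact (Finset.card_le_card this).trans (Finset.card_image_le.trans_eq (by simp))

-- A nonempty fiber is a block and its count is an entry of the profile; an empty one contributes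
-- zero on both sides.
open Classical in
theorem card_fiber_eq_of_profile_eq {β : Type*} {τ : V → β} {C C' : V → Bool}
    (h : profile (fiberPartition τ) C = profile (fiberPartition τ) C') (t : β) :
    (Finset.univ.filter (fun w => C w = true ∧ τ w = t)).card =
      (Finset.univ.filter (fun w => C' w = true ∧ τ w = t)).card := by
  by_cases ht : ∃ a, τ a = t
  · obtain ⟨a, rfl⟩ := ht
    have := congrFun h ⟨_, (mem_fiberPartition τ).2 ⟨a, rfl⟩⟩
    simp only [profile, Finset.filter_filter] at this
    simpa only [and_comm] using this
  · push Not at ht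
    simp [ht]

/-- The next state of `v` depends only on the profile if each neighborhood of `v` is a union of
blocks. -/
theorem MSyDS.succ_eq_of_profile_eq {k : ℕ} {S : MSyDS V k} (hS : S.SymmetricLocal) {v : V}
    {β : Type*} {τ : V → β}
    (hτ : ∀ i w w', τ w = τ w' → w ∈ closedNbhd (S.graph i) v → w' ∈ closedNbhd (S.graph i) v)
    {C C' : V → Bool} (h : profile (fiberPartition τ) C = profile (fiberPartition τ) C') :
    S.succ C v = S.succ C' v := by
  classical
  unfold MSyDS.succ
  congr 1
  funext i
  refine hS i v _ _ ?_
  rw [numOnes_restrict, numOnes_restrict, Set.ncard_eq_toFinset_card',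
    Set.ncard_eq_toFinset_card']
  -- By `hτ` a fiber that meets the neighborhood lies inside it, so the ones are counted over the
  -- fibers that meet it.
  have key : ∀ D : V → Bool,
      (Set.toFinset {w | w ∈ closedNbhd (S.graph i) v ∧ D w = true}).card =
      ∑ t ∈ Finset.univ.image τ, if ∃ w, τ w = t ∧ w ∈ closedNbhd (S.graph i) v then
        (Finset.univ.filter (fun w => D w = true ∧ τ w = t)).card else 0 := by
    intro D
    rw [Finset.card_eq_sum_card_fiberwise (f := τ) (t := Finset.univ.image τ)
      (fun w _ => by simp)]
    refine Finset.sum_congr rfl fun t _ => ?_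
    split_ifs with ht
    · obtain ⟨w₀, rfl, hw₀⟩ := ht
      congr 1
      ext w
      simp only [Finset.mem_filter, Finset.mem_univ, true_and, Set.mem_toFinset, Set.mem_ofPred_eq]
      exact ⟨fun h => ⟨h.1.2, h.2⟩, fun h => ⟨⟨hτ i w₀ w h.2.symm hw₀, h.1⟩, h.2⟩⟩
    · rw [Finset.card_eq_zero, Finset.filter_eq_empty_iff]
      intro w hw hwt
      simp only [Set.mem_toFinset, Set.mem_ofPred_eq] at hw
      exact ht ⟨w, hwt, hw.1⟩
  rw [key C, key C']
  simp only [card_fiber_eq_of_profile_eq h]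

open Classical in
theorem exists_profile_functions {k₀ k₁ : ℕ} {S₀ : MSyDS V k₀} {S₁ : MSyDS V k₁}
    (h₀ : S₀.SymmetricLocal) (h₁ : S₁.SymmetricLocal) :
    ∃ (P : V → Finpartition (Finset.univ : Finset V))
      (ρ₀ ρ₁ : (v : V) → ((P v).parts → ℕ) → Bool),
      (∀ v, (P v).parts.card ≤ 2 ^ (k₀ + k₁)) ∧
      (∀ v C, S₀.succ C v = ρ₀ v (profile (P v) C)) ∧
      (∀ v C, S₁.succ C v = ρ₁ v (profile (P v) C)) ∧
      (S₀.Equivalent S₁ ↔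
        ∀ v, ∀ θ : (P v).parts → ℕ, (∀ B, θ B ≤ B.1.card) → ρ₀ v θ = ρ₁ v θ) := by
  -- The type of `w` relative to `v`. As `Prop` has two elements, there are `2 ^ (k₀ + k₁)` possible
  -- types.
  let τ : V → V → (Fin k₀ → Prop) × (Fin k₁ → Prop) := fun v w =>
    (fun i => w ∈ closedNbhd (S₀.graph i) v, fun i => w ∈ closedNbhd (S₁.graph i) v)
  have e₀ : ∀ v C, S₀.succ C v =
      decide (∃ C', profile (fiberPartition (τ v)) C' = profile (fiberPartition (τ v)) C ∧
        S₀.succ C' v = true) := by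
    intro v C
    rw [Bool.eq_iff_iff, decide_eq_true_iff]
    refine ⟨fun h => ⟨C, rfl, h⟩, fun ⟨C', h, h'⟩ => ?_⟩
    rw [← h', MSyDS.succ_eq_of_profile_eq h₀ (τ := τ v) (fun i w w' hw hi => ?_) h]
    exact (congrFun (congrArg Prod.fst hw) i).mp hi
  have e₁ : ∀ v C, S₁.succ C v =
      decide (∃ C', profile (fiberPartition (τ v)) C' = profile (fiberPartition (τ v)) C ∧
        S₁.succ C' v = true) := by
    intro v C
    rw [Bool.eq_iff_iff, decide_eq_true_iff]
    refine ⟨fun h => ⟨C, rfl, h⟩, fun ⟨C', h, h'⟩ => ?_⟩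
    rw [← h', MSyDS.succ_eq_of_profile_eq h₁ (τ := τ v) (fun i w w' hw hi => ?_) h]
    exact (congrFun (congrArg Prod.snd hw) i).mp hi
  -- A count vector is mapped to the common next state of all configurations with that profile, and
  -- to `false` if there are none.
  refine ⟨fun v => fiberPartition (τ v),
    fun v θ => decide (∃ C, profile (fiberPartition (τ v)) C = θ ∧ S₀.succ C v = true),
    fun v θ => decide (∃ C, profile (fiberPartition (τ v)) C = θ ∧ S₁.succ C v = true),
    fun v => ?_, e₀, e₁, ?_⟩
  · refine (card_fiberPartition_le (τ v)).trans_eq ?_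
    simp [pow_add]
  · rw [MSyDS.equivalent_iff]
    constructor
    -- Equal successors make the definitions of the two functions coincide.
    · intro h v θ hθ
      simp only [h]
    · intro h C v
      rw [e₀, e₁]
      exact h v _ fun B => Finset.card_le_card (Finset.filter_subset _ _)

end profile

theorem mainTheorem2 :
    -- for every fixed bound on the number of layers, equivalence is decidable in polynomial time
    (∀ K : ℕ, DecidableInPolyTime
      (EquivInstance.encode : EquivInstance K → List (Option Bool)) EquivInstance.IsYes) ∧
    -- for each node there is a partition of the nodes into at most `2 ^ (k₀ + k₁)` blocks whose
    -- profile determines the next state of the node, and comparing all profiles decides equivalence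
    (∀ (V : Type u) [Fintype V] [DecidableEq V] (k₀ k₁ : ℕ) (S₀ : MSyDS V k₀) (S₁ : MSyDS V k₁),
      S₀.SymmetricLocal → S₁.SymmetricLocal →
      ∃ (P : V → Finpartition (Finset.univ : Finset V))
        (ρ₀ ρ₁ : (v : V) → ((P v).parts → ℕ) → Bool),
        (∀ v, (P v).parts.card ≤ 2 ^ (k₀ + k₁)) ∧
        (∀ v C, S₀.succ C v = ρ₀ v (profile (P v) C)) ∧
        (∀ v C, S₁.succ C v = ρ₁ v (profile (P v) C)) ∧
        (S₀.Equivalent S₁ ↔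
          ∀ v, ∀ θ : (P v).parts → ℕ, (∀ B, θ B ≤ B.1.card) → ρ₀ v θ = ρ₁ v θ)) := by
  exact ⟨EquivInstance.decidableInPolyTime,
    fun _ _ _ _ _ _ _ h₀ h₁ => exists_profile_functions h₀ h₁⟩
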